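/- **Setting.** Let $H$ be a separable real Hilbert space with inner product $(\cdot,\cdot)$ and norm $|\cdot|$, and $V$ a separable Banach space with norm $\|\cdot\|$, densely and continuously embedded in $H$, $|v|\le\alpha\|v\|$, so that $V\subset H\cong H^*\subset V^*$. Let $A:V\to V^*$ be linear and symmetric with $\sigma_0\|v\|^2\le\langle Av,v\rangle\le\sigma_1\|v\|^2$, $\sigma_0>0$, let $E:H\to H^*$, $Ev=(\cdot,v)$, and put $\lambda(v)=\langle Av,v\rangle/(v,v)$. The weak resolvent set of $A$ is the set of $s\in\mathbb R$ for which $Av-sEv=f$ is uniquely solvable for all $f\in H^*$ with bounded solution operator $H^*\to V$; its complement is the weak spectrum. Assume that the weak spectrum consists of eigenvalues $0<\lambda_1<\dots<\lambda_N$, $N\ge2$, of finite multiplicity, with eigenspaces $\mathcal E_k=\{v: Av=\lambda_kEv\}$, and of a rest contained in $[\Lambda,\infty)$ with $\Lambda>\lambda_N$, and that it is unbounded from above. Write $\|v\|_A=\langle Av,v\rangle^{1/2}$, $\|f\|_{A^{-1}}=\langle f,A^{-1}f\rangle^{1/2}$ (and likewise for $P$), $r(v)=Av-\lambda(v)Ev$,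 $\rho(v)=\|r(v)\|_{A^{-1}}/\|v\|_A$, and let $\phi_A(v,\mathcal E_1)$ be the angle between $v$ and $\mathcal E_1$ with respect to $\langle A\cdot,\cdot\rangle$. Let $P:V\to V^*$ be a symmetric isomorphism with $\|\mathrm{Id}-P^{-1}A\|_A\le\gamma_P<1$. For $\varepsilon>0$ and $v\in V$ let $A_\varepsilon(v)\in V^*$, $E_\varepsilon(v)\in H^*$ satisfy $\|A_\varepsilon(v)-Av\|_*\le\varepsilon\|v\|$ and $|E_\varepsilon(v)-Ev|_*\le\varepsilon|v|$, and put $\mu_\varepsilon(v)=\langle A_\varepsilon(v),v\rangle/\langle E_\varepsilon(v),v\rangle$, $r_\varepsilon(v)=A_\varepsilon(v)-\mu_\varepsilon(v)E_\varepsilon(v)$, $\rho_\varepsilon(v)=\|r_\varepsilon(v)\|_{P^{-1}}/\|v\|_P$. **Algorithm.** Let $c_0=\min\{1/2,\sigma_0\}$, $\gamma_\xi=(1-\gamma_P)/2$, $c_1=2(1+\sigma_0^{-1})\lambda_2$, and fix constants $$c_2\ \ge\ \sigma_0^{-1}\bigl\{1+\alpha^2[\lambda_2+\tfrac32c_1]\bigr\},\qquad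 0<c_3\le\bigl[(1+\gamma_P)c_2+\gamma_\xi c_2\bigr]^{-1}\frac{\gamma_\xi}{1+\gamma_P}.$$ $\mathrm{PPINVIT\_STEP}(v,\tau)$, for a target accuracy $\tau>0$: start with $\varepsilon:=c_0$ and repeat: if $(1-\gamma_P)^{-1}\rho_\varepsilon(v)+c_2\varepsilon\le\tau$, the target accuracy is reached, return $v$ and terminate the iteration; otherwise, if $\varepsilon\le c_3\rho_\varepsilon(v)$, return $v'=v-P^{-1}r_\varepsilon(v)$; otherwise put $\varepsilon:=\varepsilon/2$. **Theorem.** Put $\gamma=(1+\gamma_P)/2$ and $q=1-(1-\gamma)(1-\lambda_1/\lambda_2)$. There are constants $c,C>0$ depending only on the problem $(V,H,A,P)$ and on the constants $\lambda_k,\alpha,\sigma_0,\gamma_P,c_2,c_3$, and for every $\lambda^0<\lambda_2$ a constant $D>0$ depending in addition only on $\lambda^0$, such that the following holds for all approximations $A_\varepsilon,E_\varepsilon$ as above, all $\tau>0$ and all starting vectors $v^0\ne0$ with $\lambda(v^0)\le\lambda^0$. Each call of $\mathrm{PPINVIT\_STEP}$ in the iteration halts, and the iteration started at $v^0$ terminates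 after finitely many steps: it generates $v^0,v^1,\dots,v^m=v^{o}$, where the call at $v^n$ ($n<m$) returns $v^{n+1}$, and the call at $v^m$ reaches the target accuracy. If $\varepsilon_n$ denotes the (smallest) accuracy used by the call at $v^n$, then 1. $v^n\ne0$ and $\lambda_1\le\lambda(v^n)<\lambda_2$ for $n\le m$, and for $n<m$ $$\frac{\lambda(v^{n+1})-\lambda_1}{\lambda_2-\lambda(v^{n+1})}\le q^2\,\frac{\lambda(v^{n})-\lambda_1}{\lambda_2-\lambda(v^{n})};$$ 2. $c\,\rho(v^n)\le\varepsilon_n\le C\rho(v^n)$ for $n<m$; 3. the residuals decrease along with the Rayleigh quotients: $\rho(v^n)\le Dq^n$ and $\|Av^n-\lambda(v^n)Ev^n\|_{A^{-1}}\le Dq^n\|v^0\|_A$ for $n\le m$; 4. $\rho(v^{o})\le\tau$ and $\sin\phi_A(v^{o},\mathcal E_1)\le D\tau$; 5. $\varepsilon_n\ge c\max(\min(\tau,1),\rho(v^n))$ for $n\le m$; in particular $\varepsilon_n\ge c\max(\tau,\rho(v^n))$ if $\tau\le1$. -/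

import Mathlib

open scoped InnerProductSpace

noncomputable section

namespace PPINVIT

section Operators

variable {V H : Type*} [NormedAddCommGroup V] [NormedSpace ℝ V]
  [NormedAddCommGroup H] [InnerProductSpace ℝ H]

/-- The operator `E : V → V*`, `⟨E v, w⟩ = (v, w)`, induced by the inner product of `H`, where
`j : V → H` is the embedding of `V` into `H`. -/
def massOp (j : V →L[ℝ] H) : V →L[ℝ] StrongDual ℝ V :=
  (ContinuousLinearMap.precomp ℝ j).comp ((innerSL ℝ).comp j)

/-- A Gelfand triple `V ⊂ H ≅ H* ⊂ V*` with embedding `j` of norm at most `α`, and a bounded,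
symmetric and strongly positive operator `A : V → V*` with bounds `σ₀`, `σ₁`. -/
structure IsEllipticSetting (j : V →L[ℝ] H) (A : V →L[ℝ] StrongDual ℝ V) (α σ₀ σ₁ : ℝ) :
    Prop where
  embedding_injective : Function.Injective j
  embedding_dense : DenseRange j
  embedding_bound : ∀ v : V, ‖j v‖ ≤ α * ‖v‖
  symmetric : ∀ v w : V, A v w = A w v
  sigma_pos : 0 < σ₀
  lower_bound : ∀ v : V, σ₀ * ‖v‖ ^ 2 ≤ A v v
  upper_bound : ∀ v : V, A v v ≤ σ₁ * ‖v‖ ^ 2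

/-- The energy norm `‖v‖_Q = ⟨Q v, v⟩^{1/2}` of a symmetric positive operator `Q : V → V*`. -/
def energyNorm (Q : V →L[ℝ] StrongDual ℝ V) (v : V) : ℝ := √(Q v v)

/-- The norm `‖f‖_{Q⁻¹} = ⟨f, Q⁻¹ f⟩^{1/2}` on `V*`, for an invertible symmetric positive
operator `Q : V → V*`. -/
def inverseNorm (Q : V →L[ℝ] StrongDual ℝ V) (f : StrongDual ℝ V) : ℝ := √(f (Q.inverse f))

/-- The Rayleigh quotient `λ(v) = ⟨A v, v⟩ / (v, v)`. -/
def rayleigh (j : V →L[ℝ] H) (A : V →L[ℝ] StrongDual ℝ V) (v : V) : ℝ :=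
  A v v / ⟪j v, j v⟫_ℝ

/-- The residual `r(v) = A v - λ(v) E v`. -/
def residual (j : V →L[ℝ] H) (A : V →L[ℝ] StrongDual ℝ V) (v : V) : StrongDual ℝ V :=
  A v - rayleigh j A v • massOp j v

/-- The relative residual `ρ(v) = ‖A v - λ(v) E v‖_{A⁻¹} / ‖v‖_A`. -/
def rho (j : V →L[ℝ] H) (A : V →L[ℝ] StrongDual ℝ V) (v : V) : ℝ :=
  inverseNorm A (residual j A v) / energyNorm A v

/-- The weak eigenspace `{v | A v = s E v}`. -/
def weakEigenspace (j : V →L[ℝ] H) (A : V →L[ℝ] StrongDual ℝ V) (s : ℝ) : Submodule ℝ V :=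
  LinearMap.ker (A - s • massOp j : V →L[ℝ] StrongDual ℝ V).toLinearMap

/-- The weak resolvent set: all `s` such that `A v - s E v = f` is uniquely solvable in `V` for
every `f ∈ H*`, with a bounded linear solution operator `H* → V`. -/
def weakResolvent (j : V →L[ℝ] H) (A : V →L[ℝ] StrongDual ℝ V) : Set ℝ :=
  {s | ∃ R : StrongDual ℝ H →L[ℝ] V, ∀ (f : StrongDual ℝ H) (v : V),
    A v - s • massOp j v = f.comp j ↔ v = R f}

/-- The weak spectrum. -/
def weakSpectrum (j : V →L[ℝ] H) (A : V →L[ℝ] StrongDual ℝ V) : Set ℝ := (weakResolvent j A)ᶜ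

/-- The lower part of the spectrum consists of eigenvalues `0 < λ₁ < ⋯ < λ_N` with finite
dimensional eigenspaces, the rest of the spectrum is bounded from below by `Λ > λ_N`, and the
spectrum is unbounded from above. -/
structure HasDiscreteLowerSpectrum (j : V →L[ℝ] H) (A : V →L[ℝ] StrongDual ℝ V)
    (N : ℕ) (lam : ℕ → ℝ) (Λ : ℝ) : Prop where
  pos : ∀ k ∈ Set.Icc 1 N, 0 < lam k
  strictMono : StrictMonoOn lam (Set.Icc 1 N)
  isEigenvalue : ∀ k ∈ Set.Icc 1 N, weakEigenspace j A (lam k) ≠ ⊥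
  finiteDimensional : ∀ k ∈ Set.Icc 1 N, FiniteDimensional ℝ (weakEigenspace j A (lam k))
  lt_rest : ∀ k ∈ Set.Icc 1 N, lam k < Λ
  rest : ∀ s ∈ weakSpectrum j A, (∃ k ∈ Set.Icc 1 N, s = lam k) ∨ Λ ≤ s
  unbounded : ¬ BddAbove (weakSpectrum j A)

/-- The angle `φ_A(v, W)` between the vector `v` and the subspace `W` in the inner product
`⟨A ·, ·⟩`: the infimum of the angles between `v` and the nonzero elements of `W`. -/
def angleA (A : V →L[ℝ] StrongDual ℝ V) (v : V) (W : Submodule ℝ V) : ℝ :=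
  ⨅ w : {w : V // w ∈ W ∧ w ≠ 0},
    Real.arccos (A v w.1 / (energyNorm A v * energyNorm A w.1))

/-- `P` is a symmetric preconditioner of `A` with `‖Id - P⁻¹ A‖_A ≤ γP < 1`. -/
structure IsPreconditioner (A : V →L[ℝ] StrongDual ℝ V) (P : V ≃L[ℝ] StrongDual ℝ V)
    (γP : ℝ) : Prop where
  symmetric : ∀ v w : V, P v w = P w v
  lt_one : γP < 1
  contraction : ∀ v : V, energyNorm A (v - P.symm (A v)) ≤ γP * energyNorm A v

/-- The (possibly nonlinear) maps `Aop ε : V → V*` and `Eop ε : V → H*` are approximations of `A`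
and `E` of relative accuracy `ε`, for every `ε > 0`. -/
structure IsApproximation (j : V →L[ℝ] H) (A : V →L[ℝ] StrongDual ℝ V)
    (Aop : ℝ → V → StrongDual ℝ V) (Eop : ℝ → V → StrongDual ℝ H) : Prop where
  approx_A : ∀ ε > 0, ∀ v : V, ‖Aop ε v - A v‖ ≤ ε * ‖v‖
  approx_E : ∀ ε > 0, ∀ v : V, ‖Eop ε v - innerSL ℝ (j v)‖ ≤ ε * ‖j v‖

end Operators

/-- The initial accuracy `c₀ = min {1/2, σ₀}`. -/
def initialAccuracy (σ₀ : ℝ) : ℝ := min (1 / 2) σ₀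

/-- A bound `c₁` for `|μ_ε(v) - λ(v)| / ε`. -/
def boundC1 (σ₀ lam₂ : ℝ) : ℝ := 2 * (1 + σ₀⁻¹) * lam₂

/-- A bound `c₂` for `‖r_ε(v) - r(v)‖_{A⁻¹} / (ε ‖v‖_A)`. -/
def boundC2 (α σ₀ lam₂ : ℝ) : ℝ := σ₀⁻¹ * (1 + α ^ 2 * (lam₂ + boundC1 σ₀ lam₂ * (3 / 2)))

/-- The share `γ_ξ = (1 - γP) / 2` admitted for the perturbation. -/
def gammaXi (γP : ℝ) : ℝ := (1 - γP) / 2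

/-- A constant `c₃` for the accuracy test `ε ≤ c₃ ρ_ε(v)`. -/
def boundC3 (γP c₂ : ℝ) : ℝ := ((1 + γP) * c₂ + gammaXi γP * c₂)⁻¹ * (gammaXi γP / (1 + γP))

/-- The convergence factor `q(γ, λ₁, λ₂) = 1 - (1 - γ) (1 - λ₁ / λ₂)`. -/
def rate (γ lam₁ lam₂ : ℝ) : ℝ := 1 - (1 - γ) * (1 - lam₁ / lam₂)

/-- The data on which the algorithm operates: the embedding `V ⊂ H`, the preconditioner, the
approximate operators `A_ε`, `E_ε`, and the constants `γP`, `c₀`, `c₂`, `c₃`. -/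
structure Solver (V H : Type*) [NormedAddCommGroup V] [NormedSpace ℝ V]
    [NormedAddCommGroup H] [InnerProductSpace ℝ H] where
  j : V →L[ℝ] H
  P : V ≃L[ℝ] StrongDual ℝ V
  Aop : ℝ → V → StrongDual ℝ V
  Eop : ℝ → V → StrongDual ℝ H
  γP : ℝ
  c₀ : ℝ
  c₂ : ℝ
  c₃ : ℝ

/-- The two ways in which a step returns, with the final accuracy `ε`: the target accuracy is
reached (the input vector is returned), or a new vector is computed. -/
inductive Outcome (V : Type*) where
  | finished (ε : ℝ) (v : V) : Outcome V
  | updated (ε : ℝ) (v' : V) : Outcome V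

namespace Solver

variable {V H : Type*} [NormedAddCommGroup V] [NormedSpace ℝ V]
  [NormedAddCommGroup H] [InnerProductSpace ℝ H]

/-- The perturbed Rayleigh quotient `μ_ε(v) = ⟨A_ε(v), v⟩ / ⟨E_ε(v), v⟩`. -/
def mu (S : Solver V H) (ε : ℝ) (v : V) : ℝ := S.Aop ε v v / S.Eop ε v (S.j v)

/-- The approximate residual `r_ε(v) = A_ε(v) - μ_ε(v) E_ε(v)`, an element of `V*`. -/
def approxResidual (S : Solver V H) (ε : ℝ) (v : V) : StrongDual ℝ V :=
  S.Aop ε v - S.mu ε v • (S.Eop ε v).comp S.j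

/-- The estimator `ρ_ε(v) = ‖r_ε(v)‖_{P⁻¹} / ‖v‖_P`. -/
def estimator (S : Solver V H) (ε : ℝ) (v : V) : ℝ :=
  inverseNorm (S.P : V →L[ℝ] StrongDual ℝ V) (S.approxResidual ε v) /
    energyNorm (S.P : V →L[ℝ] StrongDual ℝ V) v

/-- The stopping test `(1 - γP)⁻¹ ρ_ε(v) + c₂ ε ≤ τ`. -/
def StopTest (S : Solver V H) (τ ε : ℝ) (v : V) : Prop :=
  (1 - S.γP)⁻¹ * S.estimator ε v + S.c₂ * ε ≤ τ

/-- The accuracy test `ε ≤ c₃ ρ_ε(v)`. -/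
def AccuracyTest (S : Solver V H) (ε : ℝ) (v : V) : Prop := ε ≤ S.c₃ * S.estimator ε v

/-- `S.Loop τ v ε o`: the loop of the algorithm, entered with the accuracy `ε`, halts with the
outcome `o`. -/
inductive Loop (S : Solver V H) (τ : ℝ) (v : V) : ℝ → Outcome V → Prop
  | finish (ε : ℝ) : S.StopTest τ ε v → Loop S τ v ε (.finished ε v)
  | update (ε : ℝ) : ¬ S.StopTest τ ε v → S.AccuracyTest ε v →
      Loop S τ v ε (.updated ε (v - S.P.symm (S.approxResidual ε v)))
  | halve (ε : ℝ) (o : Outcome V) : ¬ S.StopTest τ ε v → ¬ S.AccuracyTest ε v →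
      Loop S τ v (ε / 2) o → Loop S τ v ε o

/-- One call of `PPINVIT_STEP(v, τ)` halts with the outcome `o`. -/
def Step (S : Solver V H) (τ : ℝ) (v : V) (o : Outcome V) : Prop := S.Loop τ v S.c₀ o

/-- The algorithm is deterministic: a call has at most one outcome. -/
theorem Step.unique {S : Solver V H} {τ : ℝ} {v : V} {o o' : Outcome V}
    (h : S.Step τ v o) (h' : S.Step τ v o') : o = o' := by
  unfold Step at h h'
  generalize S.c₀ = e at h h'
  induction h with
  | finish ε h1 =>
    cases h' with
    | finish => rfl
    | update _ h2 => exact absurd h1 h2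
    | halve _ _ h2 => exact absurd h1 h2
  | update ε h1 h2 =>
    cases h' with
    | finish _ h3 => exact absurd h3 h1
    | update => rfl
    | halve _ _ _ h3 => exact absurd h2 h3
  | halve ε o h1 h2 _ ih =>
    cases h' with
    | finish _ h3 => exact absurd h3 h1
    | update _ _ h3 => exact absurd h3 h2
    | halve _ _ _ _ h3 => exact ih h3

/-- The iteration of `PPINVIT_STEP(·, τ)` from `v₀` performs `m` updates, with iterands
`v 0 = v₀, …, v m`, and then terminates at `v m`; `ε n` is the accuracy (the smallest one used) with
which the call at `v n` returns. -/
structure TerminatingRun (S : Solver V H) (τ : ℝ) (v₀ : V) (m : ℕ) (v : ℕ → V) (ε : ℕ → ℝ) :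
    Prop where
  start : v 0 = v₀
  updates : ∀ n < m, S.Step τ (v n) (.updated (ε n) (v (n + 1)))
  terminates : S.Step τ (v m) (.finished (ε m) (v m))

end Solver

end PPINVIT

end

/-! Let `X` be `V` with the inner product `⟨A ·, ·⟩`, and let `T = A⁻¹E`, a bounded positive
symmetric operator on `X`. Then `λ(v) = ‖x‖² / ⟨T x, x⟩`, and `ρ(v) = ‖x - λ T x‖ / ‖x‖`, where `x`
is the image of `v`. At a nonzero point `s` of the weak resolvent set `T - s⁻¹` is bounded below.
This alone, without a spectral theorem, gives `T ≤ λ₁⁻¹` on `X` and `T ≤ λ₂⁻¹` on the orthogonal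
complement of the first eigenspace (`inner_le_of_mem_orthogonal_ker`).

With `B = P⁻¹A` and the Riesz representatives `g₀`, `g` of the exact and the approximate residual,
the update satisfies `x' - λ T x = (g₀ - B g₀) - B (g - g₀)`. The first term is at most `γP ‖g₀‖`.
The accuracy test and the choice of `c₃` keep the second below `γ_ξ ‖g₀‖`. So `x'` lies in the ball
around `λ T x` of radius `γ ‖x - λ T x‖`, as for an exact preconditioned inverse iteration of
quality `γ = (1 + γP) / 2 < 1`. The geometric core, `mul_norm_sq_le_inner_of_norm_sub_le`, places
the rescaled ball inside a cone `⟨T y, y⟩ ≥ κ ‖y‖²`. The best `κ` is a bound for `1 / λ(x')`, and it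
contracts `(λ - λ₁) / (λ₂ - λ)` by `q²`.

Since `ρ² ≤ (λ - λ₁) / λ₁`, the relative residuals decay like `qⁿ`. The norms of the iterands grow
at most by the factors `1 + 2ρ`, whose product converges, so the absolute residuals decay as well.
An update is made only after the stopping test has failed, which forces `τ ≤ K ρ`; hence there are
finitely many updates. Unless the accuracy is the initial one, both tests failed at twice its value,
and this bounds it from below by multiples of `ρ` and `τ`. -/

noncomputable section

namespace PPINVIT

/-! ### Spectral bounds for symmetric operators from lower bounds on `T - t` -/

section Hilbert

variable {X : Type*} [NormedAddCommGroup X] [InnerProductSpace ℝ X]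

/-- The Cauchy–Schwarz inequality for the form of a symmetric operator that is semidefinite on a
subspace. -/
theorem inner_sq_le_of_forall_nonneg {B : X →L[ℝ] X} (hs : ∀ x y, ⟪B x, y⟫_ℝ = ⟪x, B y⟫_ℝ)
    {W : Submodule ℝ X} (hp : ∀ x ∈ W, 0 ≤ ⟪B x, x⟫_ℝ) {x y : X} (hx : x ∈ W) (hy : y ∈ W) :
    ⟪B x, y⟫_ℝ ^ 2 ≤ ⟪B x, x⟫_ℝ * ⟪B y, y⟫_ℝ := by
  have h : ∀ t : ℝ, 0 ≤ ⟪B y, y⟫_ℝ * (t * t) + 2 * ⟪B x, y⟫_ℝ * t + ⟪B x, x⟫_ℝ := fun t => by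
    have := hp (x + t • y) (W.add_mem hx (W.smul_mem t hy))
    have e : ⟪B y, x⟫_ℝ = ⟪B x, y⟫_ℝ := by rw [hs, real_inner_comm]
    simp only [map_add, map_smul, inner_add_left, inner_add_right, real_inner_smul_left,
      real_inner_smul_right, e] at this
    linarith
  have := discrim_le_zero h
  unfold discrim at this
  nlinarith

/-- If the form of a symmetric operator, semidefinite on `W`, is at most `c` at `B x`, then
`‖B x‖² ≤ c ⟨B x, x⟩`. -/
theorem norm_sq_le_of_inner_map_le {B : X →L[ℝ] X} (hs : ∀ x y, ⟪B x, y⟫_ℝ = ⟪x, B y⟫_ℝ)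
    {W : Submodule ℝ X} (hp : ∀ x ∈ W, 0 ≤ ⟪B x, x⟫_ℝ) {c : ℝ} (hc : 0 ≤ c) {x : X}
    (hxW : x ∈ W) (hBx : B x ∈ W) (hx : ⟪B (B x), B x⟫_ℝ ≤ c * ‖B x‖ ^ 2) :
    ‖B x‖ ^ 2 ≤ c * ⟪B x, x⟫_ℝ := by
  -- With `y = B x`: `‖B x‖⁴ ≤ ⟨B x, x⟩ ⟨B (B x), B x⟩`; a factor `‖B x‖²` then cancels.
  have h := inner_sq_le_of_forall_nonneg hs hp hxW hBx
  rw [real_inner_self_eq_norm_sq] at h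
  by_cases h0 : ‖B x‖ = 0
  · rw [h0]; have := mul_nonneg hc (hp x hxW); simpa using this
  · have h1 : 0 < ‖B x‖ ^ 2 := by positivity
    have h2 := mul_le_mul_of_nonneg_left hx (hp x hxW)
    nlinarith

theorem norm_sq_le_opNorm_mul_inner {B : X →L[ℝ] X} (hs : ∀ x y, ⟪B x, y⟫_ℝ = ⟪x, B y⟫_ℝ)
    (hp : ∀ x, 0 ≤ ⟪B x, x⟫_ℝ) (x : X) : ‖B x‖ ^ 2 ≤ ‖B‖ * ⟪B x, x⟫_ℝ := by
  refine norm_sq_le_of_inner_map_le hs (W := ⊤) (fun x _ => hp x) (norm_nonneg _)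
    Submodule.mem_top Submodule.mem_top ?_
  calc ⟪B (B x), B x⟫_ℝ ≤ ‖B (B x)‖ * ‖B x‖ := real_inner_le_norm _ _
    _ ≤ (‖B‖ * ‖B x‖) * ‖B x‖ := by gcongr; exact B.le_opNorm _
    _ = _ := by ring

/-- The lower bound of a symmetric semidefinite operator is a point of its approximate
point spectrum. -/
theorem le_inner_of_forall_antilipschitz {B : X →L[ℝ] X}
    (hs : ∀ x y, ⟪B x, y⟫_ℝ = ⟪x, B y⟫_ℝ) (hp : ∀ x, 0 ≤ ⟪B x, x⟫_ℝ) {S : ℝ}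
    (h : ∀ s, 0 ≤ s → s < S → ∃ c > 0, ∀ x, c * ‖x‖ ≤ ‖B x - s • x‖) (x : X) :
    S * ‖x‖ ^ 2 ≤ ⟪B x, x⟫_ℝ := by
  by_contra! hx
  have hx0 : x ≠ 0 := by rintro rfl; simp at hx
  have hn : 0 < ‖x‖ := norm_pos_iff.2 hx0
  -- If the infimum `m` of the Rayleigh quotients lay below `S`, then `B - m` would be semidefinite
  -- and bounded below, so its form would be uniformly positive. This contradicts the choice of `m`.
  set Q : Set ℝ := {r | ∃ z : X, z ≠ 0 ∧ r = ⟪B z, z⟫_ℝ / ‖z‖ ^ 2} with hQ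
  have hbdd : BddBelow Q := ⟨0, by rintro _ ⟨z, -, rfl⟩; have := hp z; positivity⟩
  have hne : Q.Nonempty := ⟨_, x, hx0, rfl⟩
  set m := sInf Q with hm
  have hm0 : 0 ≤ m := le_csInf hne (by rintro _ ⟨z, -, rfl⟩; have := hp z; positivity)
  have hmS : m < S := lt_of_le_of_lt (csInf_le hbdd ⟨x, hx0, rfl⟩) (by
    rw [div_lt_iff₀ (by positivity)]; exact hx)
  obtain ⟨c, hc, hcx⟩ := h m hm0 hmS
  have hlow : ∀ z, m * ‖z‖ ^ 2 ≤ ⟪B z, z⟫_ℝ := fun z => by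
    by_cases hz : z = 0
    · simp [hz]
    · have : 0 < ‖z‖ := norm_pos_iff.2 hz
      rw [← le_div_iff₀ (by positivity)]
      exact csInf_le hbdd ⟨z, hz, rfl⟩
  let B' : X →L[ℝ] X := B - m • ContinuousLinearMap.id ℝ X
  have hB' : ∀ z, B' z = B z - m • z := fun z => by simp [B']
  have hs' : ∀ x y, ⟪B' x, y⟫_ℝ = ⟪x, B' y⟫_ℝ := fun x y => by
    simp only [hB', inner_sub_left, inner_sub_right, real_inner_smul_left,
      real_inner_smul_right, hs]
  have hp' : ∀ z, ⟪B' z, z⟫_ℝ = ⟪B z, z⟫_ℝ - m * ‖z‖ ^ 2 := fun z => by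
    simp only [hB', inner_sub_left, real_inner_smul_left, real_inner_self_eq_norm_sq]
  have key : ∀ z, c ^ 2 * ‖z‖ ^ 2 ≤ (‖B'‖ + 1) * (⟪B z, z⟫_ℝ - m * ‖z‖ ^ 2) := fun z => by
    have h1 := norm_sq_le_opNorm_mul_inner hs' (fun z => by rw [hp']; linarith [hlow z]) z
    have h2 := hcx z
    rw [← hB'] at h2
    rw [hp'] at h1
    have h3 : (c * ‖z‖) ^ 2 ≤ ‖B' z‖ ^ 2 := by gcongr
    have := hlow z
    nlinarith
  -- The summand 1 avoids a division by `‖B'‖ = 0`.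
  have hb : 0 < ‖B'‖ + 1 := by positivity
  have : m + c ^ 2 / (‖B'‖ + 1) ≤ m := by
    refine le_csInf hne ?_
    rintro _ ⟨z, hz, rfl⟩
    have hz' : 0 < ‖z‖ := norm_pos_iff.2 hz
    rw [le_div_iff₀ (by positivity), add_mul, div_mul_eq_mul_div, ← le_sub_iff_add_le',
      div_le_iff₀ hb]
    linarith [key z]
  have : 0 < c ^ 2 / (‖B'‖ + 1) := by positivity
  linarith

/-- The form of a symmetric operator is bounded by `μ₁`, if `T - t` is bounded below for
all `t > μ₁`. -/
theorem inner_le_of_forall_antilipschitz {T : X →L[ℝ] X}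
    (hs : ∀ x y, ⟪T x, y⟫_ℝ = ⟪x, T y⟫_ℝ) {μ₁ : ℝ}
    (h : ∀ t, μ₁ < t → ∃ c > 0, ∀ x, c * ‖x‖ ≤ ‖T x - t • x‖) (x : X) :
    ⟪T x, x⟫_ℝ ≤ μ₁ * ‖x‖ ^ 2 := by
  -- Reflection: `‖T‖ - T` is semidefinite, and an upper bound for `T` is a lower bound for it.
  let B : X →L[ℝ] X := ‖T‖ • ContinuousLinearMap.id ℝ X - T
  have hB : ∀ z, B z = ‖T‖ • z - T z := fun z => by simp [B]
  have hin : ∀ z, ⟪B z, z⟫_ℝ = ‖T‖ * ‖z‖ ^ 2 - ⟪T z, z⟫_ℝ := fun z => by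
    simp only [hB, inner_sub_left, real_inner_smul_left, real_inner_self_eq_norm_sq]
  have := le_inner_of_forall_antilipschitz (B := B) (S := ‖T‖ - μ₁) (fun x y => by
      simp only [hB, inner_sub_left, inner_sub_right, real_inner_smul_left,
        real_inner_smul_right, hs]) (fun z => by
      rw [hin]
      have : ⟪T z, z⟫_ℝ ≤ ‖T‖ * ‖z‖ ^ 2 := by
        calc ⟪T z, z⟫_ℝ ≤ ‖T z‖ * ‖z‖ := real_inner_le_norm _ _
          _ ≤ (‖T‖ * ‖z‖) * ‖z‖ := by gcongr; exact T.le_opNorm _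
          _ = _ := by ring
      linarith) (fun s hs0 hsS => by
      obtain ⟨c, hc, hcx⟩ := h (‖T‖ - s) (by linarith)
      refine ⟨c, hc, fun x => (hcx x).trans (le_of_eq ?_)⟩
      rw [← norm_neg, hB, sub_smul]
      congr 1
      abel) x
  rw [hin] at this
  linarith

/-- If `T - t` is bounded below for all `t > μ₁` and all `μ₂ < t < μ₁`, then the form of `T` is
bounded by `μ₂` on the orthogonal complement of the kernel of `T - μ₁`. -/
theorem inner_le_of_mem_orthogonal_ker [CompleteSpace X] {T : X →L[ℝ] X}
    (hs : ∀ x y, ⟪T x, y⟫_ℝ = ⟪x, T y⟫_ℝ) {μ₁ μ₂ : ℝ} (h12 : μ₂ < μ₁)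
    (h : ∀ t, μ₁ < t → ∃ c > 0, ∀ x, c * ‖x‖ ≤ ‖T x - t • x‖)
    (h' : ∀ t, μ₂ < t → t < μ₁ → ∃ c > 0, ∀ x, c * ‖x‖ ≤ ‖T x - t • x‖)
    {w : X} (hw : ∀ x, T x = μ₁ • x → ⟪x, w⟫_ℝ = 0) :
    ⟪T w, w⟫_ℝ ≤ μ₂ * ‖w‖ ^ 2 := by
  let U : X →L[ℝ] X := μ₁ • ContinuousLinearMap.id ℝ X - T
  have hU : ∀ z, U z = μ₁ • z - T z := fun z => by simp [U]
  have hUs : ∀ x y, ⟪U x, y⟫_ℝ = ⟪x, U y⟫_ℝ := fun x y => by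
    simp only [hU, inner_sub_left, inner_sub_right, real_inner_smul_left,
      real_inner_smul_right, hs]
  have hUin : ∀ z, ⟪U z, z⟫_ℝ = μ₁ * ‖z‖ ^ 2 - ⟪T z, z⟫_ℝ := fun z => by
    simp only [hU, inner_sub_left, real_inner_smul_left, real_inner_self_eq_norm_sq]
  have hUp : ∀ x, 0 ≤ ⟪U x, x⟫_ℝ := fun x => by
    rw [hUin]; linarith [inner_le_of_forall_antilipschitz hs h x]
  -- Midpoint and half-width of the gap `(μ₂, μ₁)`. That `T - t` is bounded below throughout the gap
  -- amounts to `(T - c)² ≥ r²`.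
  set c := (μ₁ + μ₂) / 2 with hc
  set r := (μ₁ - μ₂) / 2 with hr
  have hr0 : 0 < r := by rw [hr]; linarith
  let F : X →L[ℝ] X := T - c • ContinuousLinearMap.id ℝ X
  have hF : ∀ z, F z = T z - c • z := fun z => by simp [F]
  have hFs : ∀ x y, ⟪F x, y⟫_ℝ = ⟪x, F y⟫_ℝ := fun x y => by
    simp only [hF, inner_sub_left, inner_sub_right, real_inner_smul_left,
      real_inner_smul_right, hs]
  have hFin : ∀ z, ⟪(F.comp F) z, z⟫_ℝ = ‖F z‖ ^ 2 := fun z => by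
    rw [ContinuousLinearMap.comp_apply, hFs, real_inner_self_eq_norm_sq]
  have hgap : ∀ z, r ^ 2 * ‖z‖ ^ 2 ≤ ‖F z‖ ^ 2 := fun z => by
    rw [← hFin]
    refine le_inner_of_forall_antilipschitz (fun x y => ?_) (fun z => ?_) (fun s hs0 hsr => ?_) z
    · rw [ContinuousLinearMap.comp_apply, hFs, hFs]; rfl
    · rw [hFin]; positivity
    · have hsq : √s < r := by rw [← Real.sqrt_sq hr0.le]; exact Real.sqrt_lt_sqrt hs0 hsr
      have hs1 := Real.sqrt_nonneg s
      -- For `s < r²` both factors of `(T - c)² - s = (T - (c + √s)) (T - (c - √s))` belong to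
      -- points of the gap.
      obtain ⟨a, ha, hax⟩ := h' (c + √s) (by linarith) (by linarith)
      obtain ⟨b, hb, hbx⟩ := h' (c - √s) (by linarith) (by linarith)
      refine ⟨a * b, by positivity, fun x => ?_⟩
      have e : (F.comp F) x - s • x = T (T x - (c - √s) • x) - (c + √s) • (T x - (c - √s) • x) := by
        have : s • x = (√s * √s) • x := by rw [Real.mul_self_sqrt hs0]
        rw [this]
        simp only [ContinuousLinearMap.comp_apply, hF, map_sub, map_smul]
        module
      rw [e]
      calc a * b * ‖x‖ = a * (b * ‖x‖) := by ring
        _ ≤ a * ‖T x - (c - √s) • x‖ := by gcongr; exact hbx x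
        _ ≤ _ := hax _
  -- Expanding `‖r z - U z‖² ≥ r² ‖z‖²` cancels the `‖z‖²` terms and leaves `U² ≥ 2 r U`.
  have hUsq : ∀ z, (μ₁ - μ₂) * ⟪U z, z⟫_ℝ ≤ ‖U z‖ ^ 2 := fun z => by
    have h1 := hgap z
    have e : F z = r • z - U z := by
      rw [hF, hU, hc, hr]; module
    rw [e, norm_sub_sq_real, real_inner_smul_left, norm_smul, Real.norm_of_nonneg hr0.le,
      real_inner_comm] at h1
    rw [hr] at h1
    nlinarith
  have hδ : 0 < μ₁ - μ₂ := by linarith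
  -- On the range of `U`, Cauchy–Schwarz for the form of `U` turns `U² ≥ (μ₁ - μ₂) U` into `U ≥ μ₁ -
  -- μ₂`. By continuity this passes to the closure of the range, which is the orthogonal complement
  -- of the kernel.
  have hrange : ∀ z, (μ₁ - μ₂) * ‖U z‖ ^ 2 ≤ ⟪U (U z), U z⟫_ℝ := fun z => by
    have h1 := inner_sq_le_of_forall_nonneg hUs (W := ⊤) (fun x _ => hUp x)
      (Submodule.mem_top (x := z)) (Submodule.mem_top (x := U z))
    rw [real_inner_self_eq_norm_sq] at h1
    have h2 := hUsq z
    have h3 := hUp (U z)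
    by_cases h0 : ‖U z‖ = 0
    · rw [h0]; simpa using h3
    · have h4 : 0 < ‖U z‖ ^ 2 := by positivity
      have h5 := mul_le_mul_of_nonneg_left h1 hδ.le
      have h6 := mul_le_mul_of_nonneg_right h2 h3
      nlinarith
  have hmem : w ∈ closure (Set.range U) := by
    have h1 := U.orthogonal_ker
    have h2 : ContinuousLinearMap.adjoint U = U :=
      ((ContinuousLinearMap.eq_adjoint_iff U U).2 hUs).symm
    rw [h2] at h1
    have h3 : w ∈ U.kerᗮ := by
      rw [Submodule.mem_orthogonal]
      intro x hx
      have : U x = 0 := hx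
      rw [hU, sub_eq_zero] at this
      exact hw x this.symm
    rw [h1] at h3
    rw [← SetLike.mem_coe, Submodule.topologicalClosure_coe] at h3
    exact h3
  have hclosed : IsClosed {z : X | (μ₁ - μ₂) * ‖z‖ ^ 2 ≤ ⟪U z, z⟫_ℝ} :=
    isClosed_le (by fun_prop) (by fun_prop)
  have := closure_minimal (by rintro _ ⟨z, rfl⟩; exact hrange z) hclosed hmem
  rw [Set.mem_ofPred_eq, hUin] at this
  linarith

end Hilbert

/-! ### The ball of possible updates lies in a cone -/

/-- The scalar inequality behind the convergence estimate for preconditioned inverse iteration. -/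
theorem sq_le_of_ball_estimates {a b d₁ d₂ R G Z k β h σ γ μ₁ μ₂ η θ p : ℝ}
    (ha : 0 ≤ a) (hR : 0 ≤ R) (hG : 0 ≤ G) (hZ : 0 ≤ Z)
    (hβ : 0 ≤ β) (hh : 1 ≤ h) (hσ : 0 ≤ σ) (hγ : 0 ≤ γ) (hγ1 : γ ≤ 1)
    (h21 : μ₂ ≤ μ₁) (hη : 0 ≤ η) (hηG : η ≤ μ₂ * G ^ 2) (hθ : 0 ≤ θ) (hθZ : θ ≤ μ₂ * Z ^ 2)
    (hd : d₁ ^ 2 + d₂ ^ 2 ≤ γ ^ 2 * R ^ 2) (hRG : R ^ 2 = μ₁ * G ^ 2 - η)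
    (hkZ : β ^ 2 * Z ^ 2 + k ^ 2 = μ₁ * Z ^ 2 - θ) (hZp : Z ^ 2 ≤ p + k * d₂)
    (hp : p ^ 2 ≤ h ^ 2 * (η * θ)) (hb : μ₁ * a - d₁ ≤ b)
    (hβa : (β * a) ^ 2 = (σ * h * G) ^ 2) (hσμ : μ₁ * σ = (1 - γ) * μ₂ + γ * μ₁)
    (hμ₂ : 0 ≤ μ₂) : Z ^ 2 ≤ β ^ 2 * b ^ 2 := by
  have hβa' : β * a = σ * h * G :=
    (pow_left_inj₀ (by positivity) (by positivity) two_ne_zero).1 hβa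
  have hGZ : 0 ≤ G * Z := by positivity
  obtain ⟨s, hs0, hs⟩ : ∃ s, 0 ≤ s ∧ s ^ 2 = η * θ :=
    ⟨√(η * θ), Real.sqrt_nonneg _, Real.sq_sqrt (by positivity)⟩
  have hRk : 0 ≤ β ^ 2 * Z ^ 2 + k ^ 2 := by positivity
  obtain ⟨l, hl0, hl⟩ : ∃ l, 0 ≤ l ∧ l ^ 2 = β ^ 2 * Z ^ 2 + k ^ 2 :=
    ⟨√(β ^ 2 * Z ^ 2 + k ^ 2), Real.sqrt_nonneg _, Real.sq_sqrt hRk⟩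
  have hps : p ≤ h * s := by
    refine le_of_sq_le_sq ?_ (by positivity)
    rw [mul_pow, hs]; exact hp
  have hdl : β * Z * d₁ + k * d₂ ≤ γ * R * l := by
    refine le_of_sq_le_sq ?_ (by positivity)
    have h1 : (β * Z * d₁ + k * d₂) ^ 2 ≤ (d₁ ^ 2 + d₂ ^ 2) * l ^ 2 := by
      rw [hl]; nlinarith [sq_nonneg (β * Z * d₂ - k * d₁)]
    have h2 := mul_le_mul_of_nonneg_right hd (sq_nonneg l)
    calc _ ≤ _ := h1
      _ ≤ _ := h2
      _ = _ := by ring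
  have hs2 : s ≤ μ₂ * (G * Z) := by
    refine le_of_sq_le_sq ?_ (by positivity)
    rw [hs]
    calc η * θ ≤ (μ₂ * G ^ 2) * (μ₂ * Z ^ 2) := by gcongr
      _ = _ := by ring
  have hs1 : s ≤ μ₁ * (G * Z) := hs2.trans (by gcongr)
  -- A reverse Cauchy–Schwarz inequality: `R² = μ₁ G² - η`, `l² = μ₁ Z² - θ` and `s² = η θ`.
  have hsr : R * l ≤ μ₁ * (G * Z) - s := by
    refine le_of_sq_le_sq ?_ (by linarith)
    have h1 : 2 * (G * Z) * s ≤ Z ^ 2 * η + G ^ 2 * θ := by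
      refine le_of_sq_le_sq ?_ (by positivity)
      have : (2 * (G * Z) * s) ^ 2 = 4 * (G ^ 2 * Z ^ 2) * (η * θ) := by rw [← hs]; ring
      rw [this]
      nlinarith [sq_nonneg (Z ^ 2 * η - G ^ 2 * θ)]
    have h2 : 0 ≤ μ₁ := hμ₂.trans h21
    have h3 := mul_le_mul_of_nonneg_left h1 h2
    rw [mul_pow, hl, hkZ, hRG]
    linear_combination h3 - hs
  -- After factoring out `h ≥ 1`, what remains is at least `(1 - γ) (μ₂ G Z - s)`, which is
  -- nonnegative. The value of `σ` is the one for which the terms in `γ` match.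
  have key : 0 ≤ Z * (β * b - Z) := by
    have h1 : β * Z * (μ₁ * a - d₁) ≤ β * Z * b := by gcongr
    have h2 : β * Z * (μ₁ * a) = h * ((μ₁ * σ) * (G * Z)) := by
      calc β * Z * (μ₁ * a) = (β * a) * (Z * μ₁) := by ring
        _ = _ := by rw [hβa']; ring
    have h3 : 0 ≤ (μ₁ * σ) * (G * Z) - s - γ * (R * l) := by
      rw [hσμ]
      have e1 := mul_le_mul_of_nonneg_left hsr hγ
      have e2 := mul_le_mul_of_nonneg_left hs2 (sub_nonneg.2 hγ1)
      linear_combination e1 + e2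
    have h4 : γ * (R * l) ≤ h * (γ * (R * l)) :=
      le_mul_of_one_le_left (by positivity) hh
    have h5 := mul_nonneg (zero_le_one.trans hh) h3
    linear_combination h1 - h2 + h4 + h5 + hps + hdl + hZp
  by_cases hZ0 : Z = 0
  · rw [hZ0, zero_pow two_ne_zero]; positivity
  · have hZpos : 0 < Z := lt_of_le_of_ne hZ (Ne.symm hZ0)
    have h1 : Z ≤ β * b := by
      have := nonneg_of_mul_nonneg_right key hZpos
      linarith
    calc Z ^ 2 ≤ (β * b) ^ 2 := by gcongr
      _ = _ := by ring

section Hilbert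

variable {X : Type*} [NormedAddCommGroup X] [InnerProductSpace ℝ X]

/-- Convergence of preconditioned inverse iteration: a ball around `T x` contained in the cone
`⟨T y, y⟩ ≥ κ ‖y‖²`. -/
theorem mul_norm_sq_le_inner_of_norm_sub_le {T : X →L[ℝ] X}
    (hs : ∀ x y, ⟪T x, y⟫_ℝ = ⟪x, T y⟫_ℝ) {E : Submodule ℝ X} [E.HasOrthogonalProjection]
    {μ₁ μ₂ μ κ σ γ : ℝ} (hE : ∀ x ∈ E, T x = μ₁ • x) (hE0 : ∀ w ∈ Eᗮ, 0 ≤ ⟪T w, w⟫_ℝ)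
    (hE2 : ∀ w ∈ Eᗮ, ⟪T w, w⟫_ℝ ≤ μ₂ * ‖w‖ ^ 2) (hμ₂ : 0 ≤ μ₂) (h2 : μ₂ < μ) (hμκ : μ ≤ κ)
    (hκ : κ ≤ μ₁) (hγ : 0 ≤ γ) (hγ1 : γ ≤ 1) (hσ : 0 ≤ σ)
    (hσμ : μ₁ * σ = (1 - γ) * μ₂ + γ * μ₁)
    (hκσ : (μ₁ - κ) * (μ - μ₂) = σ ^ 2 * ((κ - μ₂) * (μ₁ - μ)))
    {x y : X} (hx : ⟪T x, x⟫_ℝ = μ * ‖x‖ ^ 2) (hy : ‖y - T x‖ ≤ γ * ‖T x - μ • x‖) :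
    κ * ‖y‖ ^ 2 ≤ ⟪T y, y⟫_ℝ := by
  have hTW : ∀ w ∈ Eᗮ, T w ∈ Eᗮ := fun w hw => by
    rw [Submodule.mem_orthogonal]
    intro u hu
    rw [← hs, hE u hu, real_inner_smul_left, (Submodule.mem_orthogonal _ _).1 hw u hu, mul_zero]
  have hTsq : ∀ w ∈ Eᗮ, ‖T w‖ ^ 2 ≤ μ₂ * ⟪T w, w⟫_ℝ := fun w hw =>
    norm_sq_le_of_inner_map_le hs hE0 hμ₂ hw (hTW w hw) (hE2 _ (hTW w hw))
  have horth : ∀ u ∈ E, ∀ w ∈ Eᗮ, ⟪u, w⟫_ℝ = 0 := fun u hu w hw =>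
    (Submodule.mem_orthogonal _ _).1 hw u hu
  have pyth : ∀ u ∈ E, ∀ w ∈ Eᗮ, ‖u + w‖ ^ 2 = ‖u‖ ^ 2 + ‖w‖ ^ 2 := fun u hu w hw => by
    rw [norm_add_sq_real, horth u hu w hw]; ring
  have hform : ∀ u ∈ E, ∀ w ∈ Eᗮ, ⟪T (u + w), u + w⟫_ℝ = μ₁ * ‖u‖ ^ 2 + ⟪T w, w⟫_ℝ :=
    fun u hu w hw => by
      rw [map_add, hE u hu, inner_add_left, inner_add_right, inner_add_right,
        real_inner_smul_left, real_inner_smul_left, real_inner_self_eq_norm_sq,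
        horth u hu w hw, real_inner_comm, horth u hu _ (hTW w hw)]
      ring
  have hsub : ∀ (c : ℝ) (w : X),
      ‖c • w - T w‖ ^ 2 = c ^ 2 * ‖w‖ ^ 2 - 2 * c * ⟪T w, w⟫_ℝ + ‖T w‖ ^ 2 := fun c w => by
    rw [norm_sub_sq_real, norm_smul, mul_pow, Real.norm_eq_abs, sq_abs, real_inner_smul_left,
      real_inner_comm]
    ring
  obtain ⟨x₁, hx₁, w, hw, rfl⟩ := E.exists_add_mem_mem_orthogonal x
  obtain ⟨y₁, hy₁, z, hz, rfl⟩ := E.exists_add_mem_mem_orthogonal y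
  rw [hform _ hx₁ _ hw, pyth _ hx₁ _ hw] at hx
  rw [hform _ hy₁ _ hz, pyth _ hy₁ _ hz]
  have hμκ2 : 0 < κ - μ₂ := by linarith
  have hμ2 : 0 < μ - μ₂ := by linarith
  have hTw := hTsq w hw
  have hTz := hTsq z hz
  have hw0 := hE0 w hw
  have hz0 := hE0 z hz
  have hw2 := hE2 w hw
  have hz2 := hE2 z hz
  have hwsq : 0 ≤ ‖μ₂ • w - T w‖ ^ 2 := by positivity
  have hzsq : 0 ≤ ‖μ₂ • z - T z‖ ^ 2 := by positivity
  rw [hsub] at hwsq hzsq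
  have hμw := mul_nonneg hμ2.le hw0
  have hκz := mul_nonneg hμκ2.le hz0
  have hMw := mul_nonneg hμ2.le (sub_nonneg.2 hw2)
  have hKz := mul_nonneg hμκ2.le (sub_nonneg.2 hz2)
  -- the form of `κ T - T²`
  let B : X →L[ℝ] X := κ • T - T.comp T
  have hB : ∀ v, B v = κ • T v - T (T v) := fun v => by simp [B]
  have hBs : ∀ x y, ⟪B x, y⟫_ℝ = ⟪x, B y⟫_ℝ := fun x y => by
    simp only [hB, inner_sub_left, inner_sub_right, real_inner_smul_left,
      real_inner_smul_right, hs]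
  have hBin : ∀ v, ⟪B v, v⟫_ℝ = κ * ⟪T v, v⟫_ℝ - ‖T v‖ ^ 2 := fun v => by
    rw [hB, inner_sub_left, real_inner_smul_left, hs (T v), real_inner_self_eq_norm_sq]
  have hBp : ∀ v ∈ Eᗮ, 0 ≤ ⟪B v, v⟫_ℝ := fun v hv => by
    rw [hBin]
    have := hTsq v hv
    have := mul_nonneg hμκ2.le (hE0 v hv)
    linarith
  have hCS := inner_sq_le_of_forall_nonneg hBs hBp hw hz
  rw [hBin, hBin] at hCS
  have hBwz : ⟪B w, z⟫_ℝ = ⟪κ • z - T z, T w⟫_ℝ := by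
    rw [hB, inner_sub_left, inner_sub_left, real_inner_smul_left, real_inner_smul_left, hs (T w),
      real_inner_comm z, real_inner_comm (T z)]
  have hres : ‖T (x₁ + w) - μ • (x₁ + w)‖ ^ 2 =
      (μ₁ - μ) ^ 2 * ‖x₁‖ ^ 2 + ‖μ • w - T w‖ ^ 2 := by
    have e : T (x₁ + w) - μ • (x₁ + w) = (μ₁ - μ) • x₁ + -(μ • w - T w) := by
      rw [map_add, hE x₁ hx₁]; module
    rw [e, pyth _ (E.smul_mem _ hx₁) _
      (Eᗮ.neg_mem (Eᗮ.sub_mem (Eᗮ.smul_mem _ hw) (hTW w hw))), norm_neg, norm_smul, mul_pow,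
      Real.norm_eq_abs, sq_abs]
  have hdist : ‖y₁ + z - T (x₁ + w)‖ ^ 2 = ‖y₁ - μ₁ • x₁‖ ^ 2 + ‖z - T w‖ ^ 2 := by
    have e : y₁ + z - T (x₁ + w) = (y₁ - μ₁ • x₁) + (z - T w) := by
      rw [map_add, hE x₁ hx₁]; abel
    rw [e, pyth _ (E.sub_mem hy₁ (E.smul_mem _ hx₁)) _ (Eᗮ.sub_mem hz (hTW w hw))]
  have hμ₁ : 0 ≤ μ₁ := by linarith
  have hG0 : 0 ≤ (μ₁ - μ) * ‖x₁‖ ^ 2 := mul_nonneg (by linarith) (by positivity)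
  have hG : √((μ₁ - μ) * ‖x₁‖ ^ 2) ^ 2 = μ * ‖w‖ ^ 2 - ⟪T w, w⟫_ℝ := by
    rw [Real.sq_sqrt hG0]; linarith
  have hZ0 : 0 ≤ κ * ‖z‖ ^ 2 - ⟪T z, z⟫_ℝ := by
    linear_combination hz2 + mul_nonneg hμκ2.le (sq_nonneg ‖z‖)
  have hZ := Real.sq_sqrt hZ0
  have hβ := Real.sq_sqrt (show 0 ≤ μ₁ - κ by linarith)
  have hh0 : 0 ≤ (κ - μ₂) / (μ - μ₂) := by positivity
  have hh := Real.sq_sqrt hh0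
  -- Here `Z²` is the deficit `κ ‖z‖² - ⟨T z, z⟩` of the orthogonal part and `β² b²` the surplus
  -- `(μ₁ - κ) ‖y₁‖²` of the eigenpart, so `Z² ≤ β² b²` is the claim. The pair `(β Z, k)` is, up to
  -- normalization, the gradient of the cone's defining function, against which the displacement
  -- `(d₁, d₂)` from `T x` is tested.
  have main := sq_le_of_ball_estimates (a := ‖x₁‖) (b := ‖y₁‖) (d₁ := ‖y₁ - μ₁ • x₁‖)
    (d₂ := ‖z - T w‖) (R := ‖T (x₁ + w) - μ • (x₁ + w)‖) (G := √((μ₁ - μ) * ‖x₁‖ ^ 2))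
    (Z := √(κ * ‖z‖ ^ 2 - ⟪T z, z⟫_ℝ)) (k := ‖κ • z - T z‖) (β := √(μ₁ - κ))
    (h := √((κ - μ₂) / (μ - μ₂))) (σ := σ) (γ := γ) (μ₁ := μ₁) (μ₂ := μ₂)
    (η := μ * ⟪T w, w⟫_ℝ - ‖T w‖ ^ 2) (θ := κ * ⟪T z, z⟫_ℝ - ‖T z‖ ^ 2)
    (p := ⟪κ • z - T z, T w⟫_ℝ) (norm_nonneg _) (norm_nonneg _)
    (Real.sqrt_nonneg _) (Real.sqrt_nonneg _) (Real.sqrt_nonneg _)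
    (by rw [Real.one_le_sqrt, one_le_div hμ2]; linarith) hσ hγ hγ1 (by linarith)
    (by linarith) (by rw [hG]; linear_combination hwsq + hMw) (by linarith)
    (by rw [hZ]; linear_combination hzsq + hKz)
    (by rw [← hdist, ← mul_pow]; gcongr)
    (by rw [hres, hsub, hG]; linear_combination (μ₁ - μ) * hx)
    (by rw [hβ, hZ, hsub]; ring)
    (by
      rw [hZ]
      calc κ * ‖z‖ ^ 2 - ⟪T z, z⟫_ℝ = ⟪κ • z - T z, z⟫_ℝ := by
            rw [inner_sub_left, real_inner_smul_left, real_inner_self_eq_norm_sq]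
        _ = ⟪κ • z - T z, T w⟫_ℝ + ⟪κ • z - T z, z - T w⟫_ℝ := by
            rw [← inner_add_right]; congr 1; abel
        _ ≤ _ := by gcongr; exact real_inner_le_norm _ _)
    (by
      -- Cauchy–Schwarz for `κ T - T²` gives the factor `κ ⟨T w, w⟩ - ‖T w‖²`. As `‖T w‖² ≤ μ₂ ⟨T w,
      -- w⟩`, it is at most `(κ - μ₂) / (μ - μ₂)` times `η`.
      rw [← hBwz, hh]
      refine hCS.trans ?_
      rw [← mul_assoc]
      refine mul_le_mul_of_nonneg_right ?_ (by linarith)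
      rw [div_mul_eq_mul_div, le_div_iff₀ hμ2]
      linear_combination mul_nonneg (sub_nonneg.2 hμκ) (sub_nonneg.2 hTw))
    (by
      have := norm_sub_norm_le (μ₁ • x₁) (μ₁ • x₁ - y₁)
      rw [norm_smul, Real.norm_of_nonneg hμ₁, sub_sub_cancel, norm_sub_rev] at this
      exact this)
    (by
      rw [mul_pow, mul_pow, mul_pow, hβ, hh, Real.sq_sqrt hG0]
      field_simp
      linear_combination ‖x₁‖ ^ 2 * hκσ)
    hσμ hμ₂
  rw [hZ, hβ] at main
  linarith

end Hilbert

/-! ### The energy space -/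

/-- A copy of `V` that carries the energy norm. -/
def EnergySpace (V : Type*) : Type _ := V

instance (V : Type*) [AddCommGroup V] : AddCommGroup (EnergySpace V) :=
  inferInstanceAs (AddCommGroup V)

instance (V : Type*) [AddCommGroup V] [Module ℝ V] : Module ℝ (EnergySpace V) :=
  inferInstanceAs (Module ℝ V)

section Energy

variable {V : Type*} [NormedAddCommGroup V] [NormedSpace ℝ V]

/-- A symmetric, strongly positive operator `A : V → V*` turns `V` into a Hilbert space. -/
theorem exists_energySpace.{u} {V : Type u} [NormedAddCommGroup V] [NormedSpace ℝ V]
    [CompleteSpace V] {A : V →L[ℝ] StrongDual ℝ V} {σ₀ σ₁ : ℝ}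
    (hsymm : ∀ v w, A v w = A w v) (hσ : 0 < σ₀) (hlow : ∀ v, σ₀ * ‖v‖ ^ 2 ≤ A v v)
    (hupp : ∀ v, A v v ≤ σ₁ * ‖v‖ ^ 2) :
    ∃ (X : Type u) (_ : NormedAddCommGroup X) (_ : InnerProductSpace ℝ X)
      (_ : CompleteSpace X) (e : V ≃L[ℝ] X),
      ∀ v w, ⟪e v, e w⟫_ℝ = A v w := by
  have hpos : ∀ v, 0 ≤ A v v := fun v => le_trans (by positivity) (hlow v)
  let form : V → V → ℝ := fun v w => A v w
  have hadd : ∀ x y z : V, A (x + y) z = A x z + A y z := fun x y z => by simp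
  have hsmul : ∀ (x y : V) (r : ℝ), A (r • x) y = r * A x y := fun x y r => by simp
  have hdef : ∀ x : V, A x x = 0 → x = 0 := fun x hx => by
    have h1 := hlow x
    rw [hx] at h1
    have h3 : ‖x‖ ^ 2 ≤ 0 := by
      by_contra! h
      have := mul_pos hσ h
      linarith
    exact norm_eq_zero.1 ((pow_eq_zero_iff two_ne_zero).1 (le_antisymm h3 (by positivity)))
  let core : InnerProductSpace.Core ℝ (EnergySpace V) :=
    { inner := form
      conj_inner_symm := fun x y => hsymm y x
      re_inner_nonneg := hpos
      add_left := hadd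
      smul_left := hsmul
      definite := hdef }
  let i1 : NormedAddCommGroup (EnergySpace V) := core.toNormedAddCommGroup
  let i2 : InnerProductSpace ℝ (EnergySpace V) := InnerProductSpace.ofCore core.toCore
  let l : V ≃ₗ[ℝ] EnergySpace V := LinearEquiv.refl ℝ V
  have hn : ∀ v, ‖l v‖ = √(A v v) := fun v => rfl
  let e : V ≃L[ℝ] EnergySpace V := l.toContinuousLinearEquivOfBounds (√σ₁) (√σ₀)⁻¹
    (fun v => by
      rw [hn]
      by_cases hv : v = 0
      · simp [hv]
      · have hσ₁ : 0 ≤ σ₁ := by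
          have h1 : 0 < ‖v‖ ^ 2 := by have := norm_pos_iff.2 hv; positivity
          exact nonneg_of_mul_nonneg_left ((hpos v).trans (hupp v)) h1
        calc √(A v v) ≤ √(σ₁ * ‖v‖ ^ 2) := Real.sqrt_le_sqrt (hupp v)
          _ = √σ₁ * ‖v‖ := by rw [Real.sqrt_mul hσ₁, Real.sqrt_sq (norm_nonneg _)])
    (fun x => by
      obtain ⟨v, rfl⟩ := l.surjective x
      rw [LinearEquiv.symm_apply_apply, hn, inv_mul_eq_div, le_div_iff₀ (Real.sqrt_pos.2 hσ)]
      calc ‖v‖ * √σ₀ = √(σ₀ * ‖v‖ ^ 2) := by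
            rw [Real.sqrt_mul hσ.le, Real.sqrt_sq (norm_nonneg _), mul_comm]
        _ ≤ _ := Real.sqrt_le_sqrt (hlow v))
  refine ⟨EnergySpace V, i1, i2, ?_, e, fun v w => rfl⟩
  exact (completeSpace_congr (e := e.toEquiv) e.isUniformEmbedding).1 inferInstance

variable {X : Type*} [NormedAddCommGroup X] [InnerProductSpace ℝ X]
  {A : V →L[ℝ] StrongDual ℝ V} {e : V ≃L[ℝ] X}

theorem energyNorm_eq_norm (he : ∀ v w, ⟪e v, e w⟫_ℝ = A v w) (v : V) :
    energyNorm A v = ‖e v‖ := by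
  rw [energyNorm, ← he, real_inner_self_eq_norm_sq, Real.sqrt_sq (norm_nonneg _)]

theorem surjective_of_inner_eq [CompleteSpace X] (he : ∀ v w, ⟪e v, e w⟫_ℝ = A v w) :
    Function.Surjective A := fun f => by
  refine ⟨e.symm ((InnerProductSpace.toDual ℝ X).symm (f.comp (e.symm : X →L[ℝ] V))), ?_⟩
  ext w
  rw [← he, e.apply_symm_apply, InnerProductSpace.toDual_symm_apply]
  simp

theorem inverseNorm_apply [CompleteSpace V] [CompleteSpace X]
    (he : ∀ v w, ⟪e v, e w⟫_ℝ = A v w) (g : V) :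
    inverseNorm A (A g) = ‖e g‖ := by
  have hinj : A.ker = ⊥ := by
    rw [LinearMap.ker_eq_bot']
    intro v hv
    have h1 : A v v = 0 := by
      have : A v = 0 := hv
      simp [this]
    rw [← he, inner_self_eq_zero] at h1
    simpa using h1
  have hsurj : A.range = ⊤ := LinearMap.range_eq_top.2 (surjective_of_inner_eq he)
  have h1 : A.inverse (A g) = g := by
    have h2 := ContinuousLinearMap.inverse_equiv (ContinuousLinearEquiv.ofBijective A hinj hsurj)
    rw [ContinuousLinearEquiv.coe_ofBijective] at h2
    rw [h2]
    exact (ContinuousLinearEquiv.ofBijective A hinj hsurj).symm_apply_apply g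
  rw [inverseNorm, h1, ← he, real_inner_self_eq_norm_sq, Real.sqrt_sq (norm_nonneg _)]

end Energy

/-! ### The operator `T = A⁻¹E` and the weak resolvent set -/

section MassOperator

theorem massOp_apply {V H : Type*} [NormedAddCommGroup V] [NormedSpace ℝ V]
    [NormedAddCommGroup H] [InnerProductSpace ℝ H] (j : V →L[ℝ] H) (v w : V) :
    massOp j v w = ⟪j v, j w⟫_ℝ := rfl

variable {V H : Type*} [NormedAddCommGroup V] [NormedSpace ℝ V]
  [NormedAddCommGroup H] [InnerProductSpace ℝ H] [CompleteSpace H]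
  {X : Type*} [NormedAddCommGroup X] [InnerProductSpace ℝ X] [CompleteSpace X]

/-- The operator `A⁻¹ E` in the energy space. -/
def solutionOp (j : V →L[ℝ] H) (e : V ≃L[ℝ] X) : X →L[ℝ] X :=
  (ContinuousLinearMap.adjoint (j.comp (e.symm : X →L[ℝ] V))).comp
    (j.comp (e.symm : X →L[ℝ] V))

variable {j : V →L[ℝ] H} {e : V ≃L[ℝ] X} {A : V →L[ℝ] StrongDual ℝ V}

theorem inner_solutionOp (v w : V) : ⟪solutionOp j e (e v), e w⟫_ℝ = ⟪j v, j w⟫_ℝ := by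
  rw [solutionOp, ContinuousLinearMap.comp_apply, ContinuousLinearMap.adjoint_inner_left]
  simp

theorem inner_solutionOp_symm (x y : X) :
    ⟪solutionOp j e x, y⟫_ℝ = ⟪x, solutionOp j e y⟫_ℝ := by
  obtain ⟨v, rfl⟩ := e.surjective x
  obtain ⟨w, rfl⟩ := e.surjective y
  rw [inner_solutionOp, real_inner_comm (solutionOp j e (e w)), inner_solutionOp, real_inner_comm]

theorem inner_solutionOp_nonneg (x : X) : 0 ≤ ⟪solutionOp j e x, x⟫_ℝ := by
  obtain ⟨v, rfl⟩ := e.surjective x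
  rw [inner_solutionOp]
  exact real_inner_self_nonneg

theorem inner_solutionOp_pos (hj : Function.Injective j) {x : X} (hx : x ≠ 0) :
    0 < ⟪solutionOp j e x, x⟫_ℝ := by
  obtain ⟨v, rfl⟩ := e.surjective x
  rw [inner_solutionOp, real_inner_self_pos]
  intro h
  rw [← map_zero j] at h
  exact hx (by rw [hj h, map_zero])

theorem rayleigh_eq (he : ∀ v w, ⟪e v, e w⟫_ℝ = A v w) (v : V) :
    rayleigh j A v = ‖e v‖ ^ 2 / ⟪solutionOp j e (e v), e v⟫_ℝ := by
  rw [rayleigh, ← he, real_inner_self_eq_norm_sq, inner_solutionOp]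

theorem apply_symm_solutionOp (he : ∀ v w, ⟪e v, e w⟫_ℝ = A v w) (v : V) :
    A (e.symm (solutionOp j e (e v))) = massOp j v := by
  ext w
  rw [← he, e.apply_symm_apply, inner_solutionOp, massOp_apply]

theorem inverseNorm_residual [CompleteSpace V] (he : ∀ v w, ⟪e v, e w⟫_ℝ = A v w) (v : V) :
    inverseNorm A (residual j A v) =
      ‖e v - rayleigh j A v • solutionOp j e (e v)‖ := by
  have h : residual j A v = A (v - rayleigh j A v • e.symm (solutionOp j e (e v))) := by
    rw [map_sub, map_smul, apply_symm_solutionOp he, residual]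
  rw [h, inverseNorm_apply he]
  simp

theorem rho_eq [CompleteSpace V] (he : ∀ v w, ⟪e v, e w⟫_ℝ = A v w) (v : V) :
    rho j A v = ‖e v - rayleigh j A v • solutionOp j e (e v)‖ / ‖e v‖ := by
  rw [rho, inverseNorm_residual he, energyNorm_eq_norm he]

theorem mem_weakEigenspace_iff (he : ∀ v w, ⟪e v, e w⟫_ℝ = A v w) {s : ℝ} (hs : s ≠ 0) (v : V) :
    v ∈ weakEigenspace j A s ↔ solutionOp j e (e v) = s⁻¹ • e v := by
  have hA : ∀ u, A u = 0 ↔ u = 0 := fun u => by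
    refine ⟨fun h => ?_, fun h => by rw [h, map_zero]⟩
    have : ⟪e u, e u⟫_ℝ = 0 := by rw [he, h]; rfl
    rw [inner_self_eq_zero] at this
    simpa using this
  have h1 : v ∈ weakEigenspace j A s ↔ A (v - s • e.symm (solutionOp j e (e v))) = 0 := by
    rw [map_sub, map_smul, apply_symm_solutionOp he]
    rfl
  rw [h1, hA, sub_eq_zero]
  constructor
  · intro h
    nth_rw 2 [h]
    rw [map_smul, e.apply_symm_apply, inv_smul_smul₀ hs]
  · intro h
    rw [h, map_smul, e.symm_apply_apply, smul_inv_smul₀ hs]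

/-- At points of the weak resolvent set, `A⁻¹ E - s⁻¹` is bounded below. -/
theorem exists_antilipschitz_of_mem_weakResolvent (he : ∀ v w, ⟪e v, e w⟫_ℝ = A v w) {s : ℝ}
    (hs : s ≠ 0) (hres : s ∈ weakResolvent j A) :
    ∃ c > 0, ∀ x, c * ‖x‖ ≤ ‖solutionOp j e x - s⁻¹ • x‖ := by
  obtain ⟨R, hR⟩ := hres
  let D : H →L[ℝ] StrongDual ℝ H := innerSL ℝ
  have hD : ∀ h h', D h h' = ⟪h, h'⟫_ℝ := fun _ _ => rfl
  -- A bounded left inverse of `1 - s T`. With `A u = E v`, the vector `s u` solves `(A - s E) (s u)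
  -- = s E (v - s u)`. The right-hand side comes from `H*`, so `R` recovers `s u`, and hence `v`,
  -- from `v - s u`.
  let L : X →L[ℝ] X := ContinuousLinearMap.id ℝ X +
    s • ((e : V →L[ℝ] X).comp (R.comp (D.comp (j.comp (e.symm : X →L[ℝ] V)))))
  have hL : ∀ x, L (x - s • solutionOp j e x) = x := fun x => by
    obtain ⟨v, rfl⟩ := e.surjective x
    set u := e.symm (solutionOp j e (e v)) with hu
    have hAu : A u = massOp j v := apply_symm_solutionOp he v
    have h2 : s • u = R (s • D (j (v - s • u))) := by
      rw [← hR]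
      rw [map_smul, hAu, map_smul]
      ext w
      simp [massOp_apply, hD]
      ring
    have h3 : e v - s • solutionOp j e (e v) = e (v - s • u) := by
      rw [map_sub, map_smul, hu, e.apply_symm_apply]
    rw [h3]
    simp only [L, add_apply, ContinuousLinearMap.id_apply,
      smul_apply, ContinuousLinearMap.comp_apply,
      ContinuousLinearEquiv.coe_coe, e.symm_apply_apply]
    rw [← map_smul e, ← map_smul R, ← h2, ← map_add, sub_add_cancel]
  have hL0 : 0 < ‖L‖ + 1 := by positivity
  refine ⟨(|s| * (‖L‖ + 1))⁻¹, by positivity, fun x => ?_⟩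
  rw [inv_mul_le_iff₀ (by positivity)]
  calc ‖x‖ = ‖L (x - s • solutionOp j e x)‖ := by rw [hL]
    _ ≤ (‖L‖ + 1) * ‖x - s • solutionOp j e x‖ :=
        (L.le_opNorm _).trans (by gcongr; linarith)
    _ = (‖L‖ + 1) * ‖s • (solutionOp j e x - s⁻¹ • x)‖ := by
        rw [smul_sub, smul_inv_smul₀ hs, norm_sub_rev]
    _ = _ := by rw [norm_smul, Real.norm_eq_abs]; ring

end MassOperator

/-! ### From the weak spectrum to bounds for `T` -/

section Spectrum

variable {V H : Type*} [NormedAddCommGroup V] [NormedSpace ℝ V]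
  [NormedAddCommGroup H] [InnerProductSpace ℝ H] [CompleteSpace H]
  {X : Type*} [NormedAddCommGroup X] [InnerProductSpace ℝ X] [CompleteSpace X]
  {j : V →L[ℝ] H} {e : V ≃L[ℝ] X} {A : V →L[ℝ] StrongDual ℝ V}
  {N : ℕ} {lam : ℕ → ℝ} {Λ : ℝ}

section HasDiscreteLowerSpectrum

variable {V H : Type*} [NormedAddCommGroup V] [NormedSpace ℝ V]
  [NormedAddCommGroup H] [InnerProductSpace ℝ H]
  {j : V →L[ℝ] H} {A : V →L[ℝ] StrongDual ℝ V}

theorem HasDiscreteLowerSpectrum.lam_one_pos (hspec : HasDiscreteLowerSpectrum j A N lam Λ)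
    (hN : 2 ≤ N) : 0 < lam 1 := hspec.pos 1 ⟨le_rfl, by omega⟩

theorem HasDiscreteLowerSpectrum.lam_one_lt (hspec : HasDiscreteLowerSpectrum j A N lam Λ)
    (hN : 2 ≤ N) : lam 1 < lam 2 :=
  hspec.strictMono ⟨le_rfl, by omega⟩ ⟨by omega, hN⟩ (by norm_num)

theorem HasDiscreteLowerSpectrum.mem_weakResolvent (hspec : HasDiscreteLowerSpectrum j A N lam Λ)
    (hN : 2 ≤ N) {s : ℝ} (hs2 : s < lam 2) (hs1 : s ≠ lam 1) : s ∈ weakResolvent j A := by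
  by_contra h
  rcases hspec.rest s h with ⟨k, hk, rfl⟩ | h1
  · rcases lt_or_ge 1 k with h2 | h2
    · have : lam 2 ≤ lam k := hspec.strictMono.monotoneOn ⟨by omega, hN⟩ hk h2
      linarith
    · have : k = 1 := le_antisymm h2 hk.1
      exact hs1 (by rw [this])
  · have := hspec.lt_rest 2 ⟨by omega, hN⟩
    linarith

end HasDiscreteLowerSpectrum

/-- Below `λ₂` the weak spectrum can contain only `λ₁`; inversion `t = s⁻¹` turns this into a
statement about `T` above `λ₂⁻¹`. -/
theorem exists_antilipschitz_solutionOp (he : ∀ v w, ⟪e v, e w⟫_ℝ = A v w)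
    (hspec : HasDiscreteLowerSpectrum j A N lam Λ) (hN : 2 ≤ N) {t : ℝ} (ht : (lam 2)⁻¹ < t)
    (ht1 : t ≠ (lam 1)⁻¹) :
    ∃ c > 0, ∀ x, c * ‖x‖ ≤ ‖solutionOp j e x - t • x‖ := by
  have h2 : 0 < lam 2 := (hspec.lam_one_pos hN).trans (hspec.lam_one_lt hN)
  have ht0 : 0 < t := (inv_pos.2 h2).trans ht
  have := exists_antilipschitz_of_mem_weakResolvent he (s := t⁻¹) (inv_ne_zero ht0.ne')
    (hspec.mem_weakResolvent hN (inv_lt_of_inv_lt₀ h2 ht) fun h => ht1 (by rw [← h, inv_inv]))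
  rwa [inv_inv] at this

theorem inner_solutionOp_le (he : ∀ v w, ⟪e v, e w⟫_ℝ = A v w)
    (hspec : HasDiscreteLowerSpectrum j A N lam Λ) (hN : 2 ≤ N) (x : X) :
    ⟪solutionOp j e x, x⟫_ℝ ≤ (lam 1)⁻¹ * ‖x‖ ^ 2 :=
  inner_le_of_forall_antilipschitz inner_solutionOp_symm (fun _ ht =>
    exists_antilipschitz_solutionOp he hspec hN
      ((inv_strictAnti₀ (hspec.lam_one_pos hN) (hspec.lam_one_lt hN)).trans ht) ht.ne') x

/-- The first eigenspace as a subspace of the energy space. -/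
def energyEigenspace (j : V →L[ℝ] H) (e : V ≃L[ℝ] X) (A : V →L[ℝ] StrongDual ℝ V) (s : ℝ) :
    Submodule ℝ X :=
  (weakEigenspace j A s).map (e.toLinearEquiv : V →ₗ[ℝ] X)

theorem mem_energyEigenspace_iff (he : ∀ v w, ⟪e v, e w⟫_ℝ = A v w) {s : ℝ} (hs : s ≠ 0) (x : X) :
    x ∈ energyEigenspace j e A s ↔ solutionOp j e x = s⁻¹ • x := by
  constructor
  · rintro ⟨v, hv, rfl⟩
    exact (mem_weakEigenspace_iff he hs v).1 hv
  · intro h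
    refine ⟨e.symm x, (mem_weakEigenspace_iff he hs _).2 ?_, e.apply_symm_apply x⟩
    rwa [e.apply_symm_apply]

theorem inner_solutionOp_le_of_mem_orthogonal (he : ∀ v w, ⟪e v, e w⟫_ℝ = A v w)
    (hspec : HasDiscreteLowerSpectrum j A N lam Λ) (hN : 2 ≤ N) {w : X}
    (hw : w ∈ (energyEigenspace j e A (lam 1))ᗮ) :
    ⟪solutionOp j e w, w⟫_ℝ ≤ (lam 2)⁻¹ * ‖w‖ ^ 2 := by
  have h12 := inv_strictAnti₀ (hspec.lam_one_pos hN) (hspec.lam_one_lt hN)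
  refine inner_le_of_mem_orthogonal_ker inner_solutionOp_symm h12
    (fun _ ht => exists_antilipschitz_solutionOp he hspec hN (h12.trans ht) ht.ne')
    (fun _ ht ht1 => exists_antilipschitz_solutionOp he hspec hN ht ht1.ne) fun x hx => ?_
  exact (Submodule.mem_orthogonal _ _).1 hw x
    ((mem_energyEigenspace_iff he (hspec.lam_one_pos hN).ne' x).2 hx)

end Spectrum

/-! ### One step: Rayleigh quotients, residuals and norm equivalence -/

theorem rate_lt_one {γ a b : ℝ} (hγ : γ < 1) (ha : 0 < a) (hab : a < b) : rate γ a b < 1 := by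
  have h1 : a / b < 1 := (div_lt_one (ha.trans hab)).2 hab
  have := mul_pos (sub_pos.2 hγ) (sub_pos.2 h1)
  unfold rate
  linarith

theorem rate_pos {γ a b : ℝ} (hγ0 : 0 ≤ γ) (hγ : γ < 1) (ha : 0 < a) (hab : a < b) :
    0 < rate γ a b := by
  have h1 : 0 < a / b := div_pos ha (ha.trans hab)
  have := mul_pos (sub_pos.2 hγ) h1
  unfold rate
  linarith

/-- With `μ = l⁻¹` one has `(a⁻¹ - μ) / (μ - b⁻¹) = (b / a) (l - a) / (b - l)`, so a contraction in
the reciprocals is the same contraction for the Rayleigh quotients. -/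
theorem div_le_mul_div_of_inv_relation {a b l l' κ q : ℝ} (ha : 0 < a) (hab : a < b)
    (hal : a ≤ l) (hlb : l < b) (hκ : b⁻¹ < κ) (hl' : l' ≤ κ⁻¹)
    (h : (a⁻¹ - κ) * (l⁻¹ - b⁻¹) = q ^ 2 * ((κ - b⁻¹) * (a⁻¹ - l⁻¹))) :
    (l' - a) / (b - l') ≤ q ^ 2 * ((l - a) / (b - l)) := by
  have hb : 0 < b := ha.trans hab
  have hl : 0 < l := ha.trans_le hal
  have hκ0 : 0 < κ := (inv_pos.2 hb).trans hκ
  obtain ⟨m, rfl⟩ : ∃ m, κ = m⁻¹ := ⟨κ⁻¹, (inv_inv κ).symm⟩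
  rw [inv_inv] at hl'
  have hm : 0 < m := inv_pos.1 hκ0
  have hmb : m < b := (inv_lt_inv₀ hb hm).1 hκ
  have h1 : (l' - a) / (b - l') ≤ (m - a) / (b - m) := by
    rw [div_le_div_iff₀ (by linarith) (by linarith)]
    linear_combination mul_nonneg (sub_nonneg.2 hl') (sub_nonneg.2 hab.le)
  refine h1.trans (le_of_eq ?_)
  have hbl : b - l ≠ 0 := by linarith
  have hbm : b - m ≠ 0 := by linarith
  field_simp at h ⊢
  linear_combination h

section OneStep

variable {X : Type*} [NormedAddCommGroup X] [InnerProductSpace ℝ X] {T : X →L[ℝ] X}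

/-- The hypothesis says that `x` is orthogonal to `x - l T x`; this is Pythagoras. -/
theorem norm_sub_smul_sq {x : X} {l : ℝ} (h : l * ⟪T x, x⟫_ℝ = ‖x‖ ^ 2) :
    ‖x - l • T x‖ ^ 2 = l ^ 2 * ‖T x‖ ^ 2 - ‖x‖ ^ 2 := by
  rw [norm_sub_sq_real, norm_smul, mul_pow, Real.norm_eq_abs, sq_abs, real_inner_smul_right,
    real_inner_comm, h]
  ring

/-- The Rayleigh quotients of one step of perturbed preconditioned inverse iteration. -/
theorem rayleigh_step (hs : ∀ x y, ⟪T x, y⟫_ℝ = ⟪x, T y⟫_ℝ) (hpos : ∀ x ≠ 0, 0 < ⟪T x, x⟫_ℝ)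
    {E : Submodule ℝ X} [E.HasOrthogonalProjection] {a b γ : ℝ} (ha : 0 < a) (hab : a < b)
    (hE : ∀ x ∈ E, T x = a⁻¹ • x) (hT : ∀ x, ⟪T x, x⟫_ℝ ≤ a⁻¹ * ‖x‖ ^ 2)
    (hE2 : ∀ w ∈ Eᗮ, ⟪T w, w⟫_ℝ ≤ b⁻¹ * ‖w‖ ^ 2) (hγ : 0 ≤ γ) (hγ1 : γ < 1)
    {x y : X} (hx : x ≠ 0) (hxb : ‖x‖ ^ 2 / ⟪T x, x⟫_ℝ < b)
    (hy : ‖y - (‖x‖ ^ 2 / ⟪T x, x⟫_ℝ) • T x‖ ≤ γ * ‖x - (‖x‖ ^ 2 / ⟪T x, x⟫_ℝ) • T x‖) :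
    y ≠ 0 ∧ ‖y‖ ^ 2 / ⟪T y, y⟫_ℝ < b ∧
      (‖y‖ ^ 2 / ⟪T y, y⟫_ℝ - a) / (b - ‖y‖ ^ 2 / ⟪T y, y⟫_ℝ) ≤
        rate γ a b ^ 2 * ((‖x‖ ^ 2 / ⟪T x, x⟫_ℝ - a) / (b - ‖x‖ ^ 2 / ⟪T x, x⟫_ℝ)) := by
  have hb : 0 < b := ha.trans hab
  have hx0 : 0 < ‖x‖ := norm_pos_iff.2 hx
  have hTx := hpos x hx
  set l := ‖x‖ ^ 2 / ⟪T x, x⟫_ℝ with hl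
  have hl0 : 0 < l := by positivity
  have hlT : l * ⟪T x, x⟫_ℝ = ‖x‖ ^ 2 := by rw [hl]; field_simp
  have hal : a ≤ l := by
    rw [hl, le_div_iff₀ hTx]
    have := hT x
    rwa [inv_mul_eq_div, le_div_iff₀' ha] at this
  -- The origin is outside the ball, since `‖x - l T x‖ < ‖l T x‖` by orthogonality.
  have hy0 : y ≠ 0 := by
    rintro rfl
    rw [zero_sub, norm_neg] at hy
    have h1 := norm_sub_smul_sq hlT
    have h2 : ‖x - l • T x‖ ^ 2 < ‖l • T x‖ ^ 2 := by
      rw [h1, norm_smul, mul_pow, Real.norm_eq_abs, sq_abs]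
      linarith [pow_pos hx0 2]
    have h3 : ‖x - l • T x‖ < ‖l • T x‖ := lt_of_pow_lt_pow_left₀ 2 (norm_nonneg _) h2
    have h4 : γ * ‖x - l • T x‖ ≤ 1 * ‖x - l • T x‖ := by gcongr
    linarith
  have hq0 := rate_pos hγ hγ1 ha hab
  have hq1 := rate_lt_one hγ1 ha hab
  have hqa : a⁻¹ * rate γ a b = (1 - γ) * b⁻¹ + γ * a⁻¹ := by
    unfold rate
    field_simp
    ring
  set q := rate γ a b
  have hbl : b⁻¹ < l⁻¹ := inv_strictAnti₀ hl0 hxb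
  have hla : l⁻¹ ≤ a⁻¹ := inv_anti₀ ha hal
  have hba : b⁻¹ < a⁻¹ := inv_strictAnti₀ ha hab
  have hd : 0 < l⁻¹ - b⁻¹ := sub_pos.2 hbl
  -- The target value of `(a⁻¹ - κ) / (κ - b⁻¹)`; `κ` is the point of `(b⁻¹, a⁻¹]` that attains it.
  set s := q ^ 2 * (a⁻¹ - l⁻¹) / (l⁻¹ - b⁻¹) with hsdef
  have hs0 : 0 ≤ s := div_nonneg (mul_nonneg (sq_nonneg _) (sub_nonneg.2 hla)) hd.le
  have hsd : s * (l⁻¹ - b⁻¹) = q ^ 2 * (a⁻¹ - l⁻¹) := by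
    rw [hsdef, div_mul_cancel₀ _ hd.ne']
  set κ := (a⁻¹ + s * b⁻¹) / (1 + s) with hκdef
  have hs1 : 0 < 1 + s := by linarith
  have hκs : κ * (1 + s) = a⁻¹ + s * b⁻¹ := by rw [hκdef]; field_simp
  have hκ1 : (a⁻¹ - κ) * (1 + s) = s * (a⁻¹ - b⁻¹) := by linear_combination -hκs
  have hκ2 : (κ - b⁻¹) * (1 + s) = a⁻¹ - b⁻¹ := by linear_combination hκs
  have hκa : κ ≤ a⁻¹ := by
    rw [hκdef, div_le_iff₀ hs1]
    linear_combination mul_nonneg hs0 (sub_nonneg.2 hba.le)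
  have hlκ : l⁻¹ ≤ κ := by
    rw [hκdef, le_div_iff₀ hs1]
    have : q ^ 2 ≤ 1 := pow_le_one₀ hq0.le hq1.le
    linear_combination mul_nonneg (sub_nonneg.2 this) (sub_nonneg.2 hla) + hsd
  have hrel : (a⁻¹ - κ) * (l⁻¹ - b⁻¹) = q ^ 2 * ((κ - b⁻¹) * (a⁻¹ - l⁻¹)) := by
    have : (1 + s) * ((a⁻¹ - κ) * (l⁻¹ - b⁻¹)) =
        (1 + s) * (q ^ 2 * ((κ - b⁻¹) * (a⁻¹ - l⁻¹))) := by
      linear_combination (l⁻¹ - b⁻¹) * hκ1 - q ^ 2 * (a⁻¹ - l⁻¹) * hκ2 + (a⁻¹ - b⁻¹) * hsd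
    exact mul_left_cancel₀ hs1.ne' this
  have hscale : ∀ z : X, ‖l⁻¹ • z - T x‖ = l⁻¹ * ‖z - l • T x‖ := fun z => by
    rw [← Real.norm_of_nonneg (inv_pos.2 hl0).le, ← norm_smul, smul_sub,
      Real.norm_of_nonneg (inv_pos.2 hl0).le, inv_smul_smul₀ hl0.ne']
  have hball : ‖l⁻¹ • y - T x‖ ≤ γ * ‖T x - l⁻¹ • x‖ := by
    rw [norm_sub_rev (T x), hscale, hscale, mul_left_comm]
    gcongr
  have hEpos : ∀ w ∈ Eᗮ, 0 ≤ ⟪T w, w⟫_ℝ := fun w _ => by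
    by_cases hw : w = 0
    · simp [hw]
    · exact (hpos w hw).le
  have hmain := mul_norm_sq_le_inner_of_norm_sub_le hs hE hEpos hE2 (inv_pos.2 hb).le hbl hlκ hκa hγ
    hγ1.le hq0.le hqa hrel (x := x) (by rw [← hlT]; field_simp) hball
  have hκy : κ * ‖y‖ ^ 2 ≤ ⟪T y, y⟫_ℝ := by
    rw [norm_smul, mul_pow, map_smul, real_inner_smul_left, real_inner_smul_right,
      Real.norm_of_nonneg (inv_pos.2 hl0).le] at hmain
    have : 0 < l⁻¹ ^ 2 := by positivity
    refine le_of_mul_le_mul_left ?_ this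
    linear_combination hmain
  have hTy := hpos y hy0
  have hκb : b⁻¹ < κ := hbl.trans_le hlκ
  have hκ0 : 0 < κ := (inv_pos.2 hb).trans hκb
  have hyκ : ‖y‖ ^ 2 / ⟪T y, y⟫_ℝ ≤ κ⁻¹ := by
    rw [div_le_iff₀ hTy, inv_mul_eq_div, le_div_iff₀' hκ0]
    exact hκy
  exact ⟨hy0, hyκ.trans_lt (inv_lt_of_inv_lt₀ hb hκb),
    div_le_mul_div_of_inv_relation ha hab hal hxb hκb hyκ hrel⟩

theorem norm_map_sq_le_of_inner_le (hs : ∀ x y, ⟪T x, y⟫_ℝ = ⟪x, T y⟫_ℝ)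
    (hp : ∀ x, 0 ≤ ⟪T x, x⟫_ℝ) {c : ℝ} (hc : 0 ≤ c) (hT : ∀ x, ⟪T x, x⟫_ℝ ≤ c * ‖x‖ ^ 2) (x : X) :
    ‖T x‖ ^ 2 ≤ c * ⟪T x, x⟫_ℝ :=
  norm_sq_le_of_inner_map_le hs (W := ⊤) (fun x _ => hp x) hc Submodule.mem_top Submodule.mem_top
    (hT _)

/-- The residual is bounded by the error of the Rayleigh quotient. -/
theorem norm_residual_sq_le (hs : ∀ x y, ⟪T x, y⟫_ℝ = ⟪x, T y⟫_ℝ)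
    (hp : ∀ x, 0 ≤ ⟪T x, x⟫_ℝ) {a l : ℝ} (ha : 0 < a) (hT : ∀ x, ⟪T x, x⟫_ℝ ≤ a⁻¹ * ‖x‖ ^ 2)
    {x : X} (hl : l * ⟪T x, x⟫_ℝ = ‖x‖ ^ 2) :
    ‖x - l • T x‖ ^ 2 ≤ (l - a) / a * ‖x‖ ^ 2 := by
  have h := norm_map_sq_le_of_inner_le hs hp (inv_pos.2 ha).le hT x
  rw [norm_sub_smul_sq hl]
  have h1 := mul_le_mul_of_nonneg_left h (sq_nonneg l)
  have h2 : l ^ 2 * (a⁻¹ * ⟪T x, x⟫_ℝ) = l / a * ‖x‖ ^ 2 := by rw [← hl]; ring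
  have h3 : (l - a) / a = l / a - 1 := by field_simp
  rw [h3]
  linarith

/-- The part of a vector orthogonal to the first eigenspace is bounded by the residual. -/
theorem norm_orthogonal_part_le {E : Submodule ℝ X}
    {a b l : ℝ} (hE : ∀ x ∈ E, T x = a⁻¹ • x)
    (hE2 : ∀ w ∈ Eᗮ, ⟪T w, w⟫_ℝ ≤ b⁻¹ * ‖w‖ ^ 2) (hl0 : 0 < l) (hb : 0 < b)
    {u w : X} (hu : u ∈ E) (hw : w ∈ Eᗮ) :
    (b - l) * ‖w‖ ≤ b * ‖(u + w) - l • T (u + w)‖ := by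
  have horth : ⟪u, w⟫_ℝ = 0 := (Submodule.mem_orthogonal _ _).1 hw u hu
  have h1 : ⟪(u + w) - l • T (u + w), w⟫_ℝ = ‖w‖ ^ 2 - l * ⟪T w, w⟫_ℝ := by
    rw [inner_sub_left, inner_add_left, real_inner_smul_left, map_add, inner_add_left, hE u hu,
      real_inner_smul_left, horth, real_inner_self_eq_norm_sq]
    ring
  have h2 : ⟪(u + w) - l • T (u + w), w⟫_ℝ ≤ ‖(u + w) - l • T (u + w)‖ * ‖w‖ :=
    real_inner_le_norm _ _
  have h3 := mul_le_mul_of_nonneg_left (hE2 w hw) hl0.le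
  have h4 : (b - l) * ‖w‖ * ‖w‖ ≤ b * ‖(u + w) - l • T (u + w)‖ * ‖w‖ := by
    have h5 : b * (l * (b⁻¹ * ‖w‖ ^ 2)) = l * ‖w‖ ^ 2 := by field_simp
    have h6 := mul_le_mul_of_nonneg_left (h1 ▸ h2) hb.le
    have h7 := mul_le_mul_of_nonneg_left h3 hb.le
    linear_combination h6 + h7 + h5
  by_cases hw0 : ‖w‖ = 0
  · rw [hw0, mul_zero]; positivity
  · exact le_of_mul_le_mul_right h4 (lt_of_le_of_ne (norm_nonneg _) (Ne.symm hw0))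

/-- Norm equivalences for a symmetric operator close to the identity. -/
theorem sqrt_inner_div_mem {B : X →L[ℝ] X} (hs : ∀ x y, ⟪B x, y⟫_ℝ = ⟪x, B y⟫_ℝ) {γ : ℝ}
    (hγ : 0 ≤ γ) (hγ1 : γ < 1) (hB : ∀ x, ‖x - B x‖ ≤ γ * ‖x‖) (g h : X) :
    (1 - γ) * (‖g‖ / ‖B h‖) ≤ √⟪B g, g⟫_ℝ / √⟪B h, h⟫_ℝ ∧
      √⟪B g, g⟫_ℝ / √⟪B h, h⟫_ℝ ≤ (1 + γ) * (‖g‖ / ‖B h‖) := by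
  have habs : ∀ x, |⟪x, x⟫_ℝ - ⟪B x, x⟫_ℝ| ≤ γ * ‖x‖ ^ 2 := fun x => by
    rw [← inner_sub_left]
    calc _ ≤ ‖x - B x‖ * ‖x‖ := abs_real_inner_le_norm _ _
      _ ≤ γ * ‖x‖ * ‖x‖ := by gcongr; exact hB x
      _ = _ := by ring
  have hlow : ∀ x, (1 - γ) * ‖x‖ ^ 2 ≤ ⟪B x, x⟫_ℝ := fun x => by
    have := (abs_le.1 (habs x)).2
    rw [real_inner_self_eq_norm_sq] at this
    linarith
  have hupp : ∀ x, ⟪B x, x⟫_ℝ ≤ (1 + γ) * ‖x‖ ^ 2 := fun x => by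
    have := (abs_le.1 (habs x)).1
    rw [real_inner_self_eq_norm_sq] at this
    linarith
  have h1γ : 0 < 1 - γ := sub_pos.2 hγ1
  have hp : ∀ x, 0 ≤ ⟪B x, x⟫_ℝ := fun x => le_trans (by positivity) (hlow x)
  by_cases hh : h = 0
  · simp [hh]
  have hh0 : 0 < ‖h‖ := norm_pos_iff.2 hh
  have hb : 0 < ⟪B h, h⟫_ℝ := lt_of_lt_of_le (by positivity) (hlow h)
  have hBh : (1 - γ) * ‖h‖ ≤ ‖B h‖ := by
    have := norm_sub_norm_le h (h - B h)
    rw [sub_sub_cancel] at this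
    linarith [hB h]
  have hBh0 : 0 < ‖B h‖ := lt_of_lt_of_le (by positivity) hBh
  -- Numerator and denominator each cost a factor `√(1 ± γ)`. Comparing `⟨B h, h⟩` with `‖B h‖²`
  -- instead of `‖h‖²` keeps the total at `1 ± γ`.
  have hu : ‖B h‖ ^ 2 ≤ (1 + γ) * ⟪B h, h⟫_ℝ :=
    norm_map_sq_le_of_inner_le hs hp (by linarith) hupp h
  have hl : (1 - γ) * ⟪B h, h⟫_ℝ ≤ ‖B h‖ ^ 2 := by
    have h1 : ⟪B h, h⟫_ℝ ≤ ‖B h‖ * ‖h‖ := real_inner_le_norm _ _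
    calc (1 - γ) * ⟪B h, h⟫_ℝ ≤ (1 - γ) * (‖B h‖ * ‖h‖) := by gcongr
      _ = ‖B h‖ * ((1 - γ) * ‖h‖) := by ring
      _ ≤ ‖B h‖ * ‖B h‖ := by gcongr
      _ = _ := by ring
  rw [← Real.sqrt_div (hp g)]
  constructor
  · refine Real.le_sqrt_of_sq_le ?_
    rw [mul_pow, div_pow, ← mul_div_assoc, div_le_div_iff₀ (by positivity) hb]
    calc (1 - γ) ^ 2 * ‖g‖ ^ 2 * ⟪B h, h⟫_ℝ
        = ((1 - γ) * ‖g‖ ^ 2) * ((1 - γ) * ⟪B h, h⟫_ℝ) := by ring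
      _ ≤ ⟪B g, g⟫_ℝ * ‖B h‖ ^ 2 := mul_le_mul (hlow g) hl (by positivity) (hp g)
  · refine Real.sqrt_le_iff.2 ⟨by positivity, ?_⟩
    rw [mul_pow, div_pow, ← mul_div_assoc, div_le_div_iff₀ hb (by positivity)]
    calc ⟪B g, g⟫_ℝ * ‖B h‖ ^ 2 ≤ ((1 + γ) * ‖g‖ ^ 2) * ((1 + γ) * ⟪B h, h⟫_ℝ) :=
          mul_le_mul (hupp g) hu (by positivity) (by positivity)
      _ = _ := by ring

end OneStep

/-! ### Halting of a single call and the accuracy it uses -/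

theorem initialAccuracy_pos {σ₀ : ℝ} (h : 0 < σ₀) : 0 < initialAccuracy σ₀ :=
  lt_min (by norm_num) h

namespace Solver

variable {V H : Type*} [NormedAddCommGroup V] [NormedSpace ℝ V]
  [NormedAddCommGroup H] [InnerProductSpace ℝ H]

theorem Loop.of_halvings {S : Solver V H} {τ : ℝ} {v : V} {o : Outcome V} :
    ∀ (k : ℕ) (ε : ℝ), (∀ i < k, ¬ (S.StopTest τ (ε / 2 ^ i) v ∨ S.AccuracyTest (ε / 2 ^ i) v)) →
      S.Loop τ v (ε / 2 ^ k) o → S.Loop τ v ε o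
  | 0, ε, _, h => by simpa using h
  | k + 1, ε, hn, h => by
    have h0 := hn 0 (Nat.succ_pos k)
    rw [pow_zero, div_one, not_or] at h0
    refine .halve ε o h0.1 h0.2 (Loop.of_halvings k (ε / 2) (fun i hi => ?_) ?_)
    · have := hn (i + 1) (Nat.succ_lt_succ hi)
      rwa [pow_succ', ← div_div] at this
    · rwa [pow_succ', ← div_div] at h

/-- A step halts as soon as one of the two tests is passed for some accuracy `c₀ / 2 ^ k`. -/
theorem exists_step {S : Solver V H} {τ : ℝ} {v : V} (hc₀ : 0 < S.c₀)
    (h : ∃ k : ℕ, S.StopTest τ (S.c₀ / 2 ^ k) v ∨ S.AccuracyTest (S.c₀ / 2 ^ k) v) :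
    ∃ ε, 0 < ε ∧ ε ≤ S.c₀ ∧
      (ε = S.c₀ ∨ (2 * ε ≤ S.c₀ ∧ ¬ S.StopTest τ (2 * ε) v ∧ ¬ S.AccuracyTest (2 * ε) v)) ∧
      ((S.StopTest τ ε v ∧ S.Step τ v (.finished ε v)) ∨
        (¬ S.StopTest τ ε v ∧ S.AccuracyTest ε v ∧
          S.Step τ v (.updated ε (v - S.P.symm (S.approxResidual ε v))))) := by
  classical
  have hk := Nat.find_spec h
  have hmin := fun i (hi : i < Nat.find h) => Nat.find_min h hi
  set k := Nat.find h
  have hle : S.c₀ / 2 ^ k ≤ S.c₀ := div_le_self hc₀.le (one_le_pow₀ one_le_two)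
  refine ⟨S.c₀ / 2 ^ k, by positivity, hle, ?_, ?_⟩
  · rcases Nat.eq_zero_or_pos k with h0 | h0
    · left; rw [h0, pow_zero, div_one]
    · right
      have h1 := hmin (k - 1) (by omega)
      have h2 : 2 * (S.c₀ / 2 ^ k) = S.c₀ / 2 ^ (k - 1) := by
        obtain ⟨i, hi⟩ : ∃ i, k = i + 1 := ⟨k - 1, by omega⟩
        rw [hi, Nat.add_sub_cancel, pow_succ]
        field_simp
      rw [h2]
      exact ⟨div_le_self hc₀.le (one_le_pow₀ one_le_two), not_or.1 h1⟩
  · by_cases hs : S.StopTest τ (S.c₀ / 2 ^ k) v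
    · exact Or.inl ⟨hs, Loop.of_halvings k S.c₀ hmin (.finish _ hs)⟩
    · have ha := hk.resolve_left hs
      exact Or.inr ⟨hs, ha, Loop.of_halvings k S.c₀ hmin (.update _ hs ha)⟩

/-- One call of the algorithm, if the estimator is equivalent to `ρ` up to a perturbation that is
proportional to the accuracy. -/
theorem exists_step_of_estimator_bounds {S : Solver V H} {τ : ℝ} {v : V} {ρ γξ : ℝ}
    (hc₀ : 0 < S.c₀) (hc₂ : 0 < S.c₂) (hc₃ : 0 < S.c₃) (hγ : 0 ≤ S.γP) (hγ1 : S.γP < 1)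
    (hγξ : 0 < γξ)
    (hc₃' : S.c₃ ≤ ((1 + S.γP) * S.c₂ + γξ * S.c₂)⁻¹ * (γξ / (1 + S.γP))) (hτ : 0 < τ)
    (hρ : 0 ≤ ρ)
    (hlow : ∀ ε, 0 < ε → ε ≤ S.c₀ → (1 - S.γP) * (ρ - S.c₂ * ε) ≤ S.estimator ε v)
    (hupp : ∀ ε, 0 < ε → ε ≤ S.c₀ → S.estimator ε v ≤ (1 + S.γP) * (ρ + S.c₂ * ε)) :
    ∃ ε, 0 < ε ∧ ε ≤ S.c₀ ∧
      (ε = S.c₀ ∨ (S.c₃ * (1 - S.γP) * ρ ≤ 2 * (1 + S.c₃ * (1 - S.γP) * S.c₂) * ε ∧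
        τ ≤ 2 * ((1 - S.γP)⁻¹ / S.c₃ + S.c₂) * ε)) ∧
      ((ρ ≤ τ ∧ S.Step τ v (.finished ε v)) ∨
        ((1 + S.γP) * S.c₂ * ε ≤ γξ * ρ ∧
          τ ≤ (1 - S.γP)⁻¹ * ((1 + S.γP) * (ρ + S.c₂ * ε)) + S.c₂ * ε ∧
          S.Step τ v (.updated ε (v - S.P.symm (S.approxResidual ε v))))) := by
  have h1γ : 0 < 1 - S.γP := sub_pos.2 hγ1
  have hhalt : ∃ k : ℕ, S.StopTest τ (S.c₀ / 2 ^ k) v ∨ S.AccuracyTest (S.c₀ / 2 ^ k) v := by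
    have hex : ∀ η > 0, ∃ k : ℕ, S.c₀ / 2 ^ k ≤ η := fun η hη => by
      obtain ⟨k, hk⟩ := exists_pow_lt_of_lt_one (div_pos hη hc₀) (show (1 / 2 : ℝ) < 1 by norm_num)
      refine ⟨k, ?_⟩
      rw [lt_div_iff₀ hc₀, one_div, inv_pow] at hk
      rw [div_eq_inv_mul]
      exact hk.le
    have hpos : ∀ k : ℕ, 0 < S.c₀ / 2 ^ k ∧ S.c₀ / 2 ^ k ≤ S.c₀ := fun k =>
      ⟨by positivity, div_le_self hc₀.le (one_le_pow₀ one_le_two)⟩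
    -- If `ρ = 0`, the estimator tends to 0 with the accuracy and the stopping test passes. If `ρ >
    -- 0`, the estimator stays away from 0 and the accuracy test passes.
    rcases hρ.eq_or_lt with h0 | h0
    · have hK : 0 < (1 - S.γP)⁻¹ * ((1 + S.γP) * S.c₂) + S.c₂ := by positivity
      obtain ⟨k, hk⟩ := hex (τ / ((1 - S.γP)⁻¹ * ((1 + S.γP) * S.c₂) + S.c₂)) (by positivity)
      refine ⟨k, Or.inl ?_⟩
      have h1 := hupp _ (hpos k).1 (hpos k).2
      rw [le_div_iff₀ hK] at hk
      rw [← h0] at h1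
      unfold StopTest
      have h2 := mul_le_mul_of_nonneg_left h1 (inv_pos.2 h1γ).le
      linear_combination h2 + hk
    · have hK : 0 < 1 + S.c₃ * (1 - S.γP) * S.c₂ := by positivity
      obtain ⟨k, hk⟩ := hex (S.c₃ * (1 - S.γP) * ρ / (1 + S.c₃ * (1 - S.γP) * S.c₂))
        (by positivity)
      refine ⟨k, Or.inr ?_⟩
      have h1 := hlow _ (hpos k).1 (hpos k).2
      rw [le_div_iff₀ hK] at hk
      unfold AccuracyTest
      have h2 := mul_le_mul_of_nonneg_left h1 hc₃.le
      linear_combination h2 + hk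
  obtain ⟨ε, hε, hε₀, hfirst, hout⟩ := exists_step hc₀ hhalt
  refine ⟨ε, hε, hε₀, ?_, ?_⟩
  · refine hfirst.imp_right fun ⟨h2, hs, ha⟩ => ?_
    have h1 := hlow (2 * ε) (by positivity) h2
    unfold StopTest at hs
    unfold AccuracyTest at ha
    push Not at hs ha
    refine ⟨?_, ?_⟩
    · have h3 := mul_le_mul_of_nonneg_left h1 hc₃.le
      linear_combination h3 + ha
    -- The failed accuracy test bounds the estimator by the accuracy, so the failed stopping test
    -- bounds `τ` by the accuracy.
    · have h3 : S.estimator (2 * ε) v ≤ 2 * ε / S.c₃ := by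
        rw [le_div_iff₀ hc₃]; linarith
      have h4 := mul_le_mul_of_nonneg_left h3 (inv_pos.2 h1γ).le
      linear_combination h4 + hs
  · refine hout.imp (fun ⟨hs, hstep⟩ => ⟨?_, hstep⟩) fun ⟨hs, ha, hstep⟩ => ⟨?_, ?_, hstep⟩
    · unfold StopTest at hs
      have h1 := mul_le_mul_of_nonneg_left (hlow ε hε hε₀) (inv_pos.2 h1γ).le
      rw [inv_mul_cancel_left₀ h1γ.ne'] at h1
      linarith
    · unfold AccuracyTest at ha
      have h1 := hupp ε hε hε₀
      have hest : 0 ≤ S.estimator ε v := by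
        by_contra! hneg
        have := mul_pos_of_neg_of_neg (a := -S.c₃) (by linarith) hneg
        linarith
      have hK : 0 < (1 + S.γP) * S.c₂ + γξ * S.c₂ := by positivity
      have h1γ' : 0 < 1 + S.γP := by positivity
      -- The two summands in the bound for `c₃` have separate roles: the term with `γξ` absorbs the
      -- `γξ c₂ ε` that arises from bounding the estimator by `ρ + c₂ ε`, and the other is the
      -- perturbation to be controlled.
      have h2 : S.c₃ * (1 + S.γP) * ((1 + S.γP) * S.c₂ + γξ * S.c₂) ≤ γξ := by
        calc _ ≤ ((1 + S.γP) * S.c₂ + γξ * S.c₂)⁻¹ * (γξ / (1 + S.γP)) * (1 + S.γP) *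
              ((1 + S.γP) * S.c₂ + γξ * S.c₂) := by gcongr
          _ = γξ := by field_simp
      have h3 : ε ≤ S.c₃ * ((1 + S.γP) * (ρ + S.c₂ * ε)) :=
        ha.trans (mul_le_mul_of_nonneg_left h1 hc₃.le)
      have h4 : ε * ((1 + S.γP) * S.c₂ + γξ * S.c₂) ≤ γξ * (ρ + S.c₂ * ε) := by
        calc _ ≤ S.c₃ * ((1 + S.γP) * (ρ + S.c₂ * ε)) * ((1 + S.γP) * S.c₂ + γξ * S.c₂) := by
              gcongr
          _ = S.c₃ * (1 + S.γP) * ((1 + S.γP) * S.c₂ + γξ * S.c₂) * (ρ + S.c₂ * ε) := by ring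
          _ ≤ _ := by gcongr
      linear_combination h4
    · unfold StopTest at hs
      push Not at hs
      have h1 := mul_le_mul_of_nonneg_left (hupp ε hε hε₀) (inv_pos.2 h1γ).le
      linarith

/-! ### Perturbation of the residual and of the update -/

variable {A : V →L[ℝ] StrongDual ℝ V} {α σ₀ σ₁ : ℝ}

/-- The perturbation of the residual in the dual norm of `V`. -/
theorem norm_approxResidual_sub_le {S : Solver V H} (hA : IsEllipticSetting S.j A α σ₀ σ₁)
    (happ : IsApproximation S.j A S.Aop S.Eop) {ε : ℝ} (hε : 0 < ε)
    (hε₀ : ε ≤ initialAccuracy σ₀) {v : V} (hv : v ≠ 0) {l₂ : ℝ} (hl : rayleigh S.j A v ≤ l₂) :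
    ‖S.approxResidual ε v - residual S.j A v‖ ≤ σ₀ * boundC2 α σ₀ l₂ * (ε * ‖v‖) := by
  have hσ := hA.sigma_pos
  have hv0 : 0 < ‖v‖ := norm_pos_iff.2 hv
  have hj0 : 0 < ‖S.j v‖ := norm_pos_iff.2 fun h =>
    hv (hA.embedding_injective (by rw [h, map_zero]))
  have hjα := hA.embedding_bound v
  have hα : 0 < α := pos_of_mul_pos_left (hj0.trans_le hjα) hv0.le
  have hε1 : ε ≤ 1 / 2 := hε₀.trans (min_le_left _ _)
  have hA1 := happ.approx_A ε hε v
  have hE1 := happ.approx_E ε hε v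
  set l := rayleigh S.j A v with hldef
  have hll : l * ‖S.j v‖ ^ 2 = A v v := by
    rw [hldef, rayleigh, real_inner_self_eq_norm_sq]
    field_simp
  have hlow := hA.lower_bound v
  have hl0 : 0 ≤ l := by
    have : 0 ≤ l * ‖S.j v‖ ^ 2 := by rw [hll]; exact le_trans (by positivity) hlow
    exact nonneg_of_mul_nonneg_left this (by positivity)
  have hl₂ : 0 ≤ l₂ := hl0.trans hl
  have hvl : ‖v‖ ^ 2 ≤ σ₀⁻¹ * (l * ‖S.j v‖ ^ 2) := by
    rw [hll, inv_mul_eq_div, le_div_iff₀' hσ]; exact hlow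
  have hAv : |S.Aop ε v v - A v v| ≤ ε * ‖v‖ ^ 2 := by
    calc _ = ‖(S.Aop ε v - A v) v‖ := rfl
      _ ≤ ‖S.Aop ε v - A v‖ * ‖v‖ := (S.Aop ε v - A v).le_opNorm v
      _ ≤ ε * ‖v‖ * ‖v‖ := by gcongr
      _ = _ := by ring
  have hEv : |S.Eop ε v (S.j v) - ‖S.j v‖ ^ 2| ≤ ε * ‖S.j v‖ ^ 2 := by
    rw [← real_inner_self_eq_norm_sq (S.j v)]
    calc _ = ‖(S.Eop ε v - innerSL ℝ (S.j v)) (S.j v)‖ := rfl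
      _ ≤ ‖S.Eop ε v - innerSL ℝ (S.j v)‖ * ‖S.j v‖ :=
          (S.Eop ε v - innerSL ℝ (S.j v)).le_opNorm _
      _ ≤ ε * ‖S.j v‖ * ‖S.j v‖ := by gcongr
      _ = _ := by rw [real_inner_self_eq_norm_sq]; ring
  have hEpos : ‖S.j v‖ ^ 2 / 2 ≤ S.Eop ε v (S.j v) := by
    have h1 := (abs_le.1 hEv).1
    have h2 : ε * ‖S.j v‖ ^ 2 ≤ 1 / 2 * ‖S.j v‖ ^ 2 := by gcongr
    linarith
  have hE0 : 0 < S.Eop ε v (S.j v) := lt_of_lt_of_le (by positivity) hEpos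
  have hc1 : 0 ≤ boundC1 σ₀ l₂ := by unfold boundC1; positivity
  -- As `ε ≤ 1/2`, the denominator is at least half of `‖j v‖²`, whence the factor 2 in `boundC1`.
  -- The summand `σ₀⁻¹` comes from `‖v‖² ≤ σ₀⁻¹ λ ‖j v‖²`.
  have hmu : |S.mu ε v - l| ≤ boundC1 σ₀ l₂ * ε := by
    have e1 : S.mu ε v - l = (S.Aop ε v v - l * S.Eop ε v (S.j v)) / S.Eop ε v (S.j v) := by
      rw [mu]; field_simp
    rw [e1, abs_div, abs_of_pos hE0, div_le_iff₀ hE0]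
    have e2 : S.Aop ε v v - l * S.Eop ε v (S.j v) =
        (S.Aop ε v v - A v v) - l * (S.Eop ε v (S.j v) - ‖S.j v‖ ^ 2) := by
      rw [← hll]; ring
    rw [e2]
    calc _ ≤ |S.Aop ε v v - A v v| + |l * (S.Eop ε v (S.j v) - ‖S.j v‖ ^ 2)| := abs_sub _ _
      _ ≤ ε * ‖v‖ ^ 2 + l * (ε * ‖S.j v‖ ^ 2) := by
          rw [abs_mul, abs_of_nonneg hl0]; gcongr
      _ ≤ ε * (σ₀⁻¹ * (l * ‖S.j v‖ ^ 2)) + l * (ε * ‖S.j v‖ ^ 2) := by gcongr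
      _ = (1 + σ₀⁻¹) * l * ε * ‖S.j v‖ ^ 2 := by ring
      _ ≤ (1 + σ₀⁻¹) * l₂ * ε * ‖S.j v‖ ^ 2 := by gcongr
      _ = boundC1 σ₀ l₂ * ε * (‖S.j v‖ ^ 2 / 2) := by unfold boundC1; ring
      _ ≤ _ := by gcongr
  have hjop : ‖S.j‖ ≤ α := S.j.opNorm_le_bound hα.le hA.embedding_bound
  have hEn : ‖S.Eop ε v‖ ≤ 3 / 2 * (α * ‖v‖) := by
    calc ‖S.Eop ε v‖ = ‖(S.Eop ε v - innerSL ℝ (S.j v)) + innerSL ℝ (S.j v)‖ := by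
          rw [sub_add_cancel]
      _ ≤ ε * ‖S.j v‖ + ‖S.j v‖ := by
          refine (norm_add_le _ _).trans ?_
          rw [innerSL_apply_norm]
          gcongr
      _ ≤ 1 / 2 * ‖S.j v‖ + ‖S.j v‖ := by gcongr
      _ = 3 / 2 * ‖S.j v‖ := by ring
      _ ≤ _ := by gcongr
  -- Attaching the error of the quotient to `E_ε`, with `‖E_ε(v)‖ ≤ 3/2 ‖j v‖`, produces the factor
  -- `3/2` in `boundC2`.
  have hdec : S.approxResidual ε v - residual S.j A v = (S.Aop ε v - A v) -
      ((S.mu ε v - l) • (S.Eop ε v).comp S.j +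
        l • (S.Eop ε v - innerSL ℝ (S.j v)).comp S.j) := by
    ext w
    simp only [approxResidual, residual, sub_apply, smul_apply, add_apply, smul_eq_mul,
      ContinuousLinearMap.comp_apply, massOp_apply, innerSL_apply_apply, ← hldef]
    ring
  rw [hdec]
  have hσC : σ₀ * boundC2 α σ₀ l₂ = 1 + α ^ 2 * (l₂ + boundC1 σ₀ l₂ * (3 / 2)) := by
    unfold boundC2; field_simp
  rw [hσC]
  calc _ ≤ ‖S.Aop ε v - A v‖ + (‖(S.mu ε v - l) • (S.Eop ε v).comp S.j‖ +
        ‖l • (S.Eop ε v - innerSL ℝ (S.j v)).comp S.j‖) :=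
        (norm_sub_le _ _).trans (by gcongr; exact norm_add_le _ _)
    _ ≤ ε * ‖v‖ + (boundC1 σ₀ l₂ * ε * (3 / 2 * (α * ‖v‖) * α) +
        l₂ * (ε * (α * ‖v‖) * α)) := by
        rw [norm_smul, norm_smul, Real.norm_eq_abs, Real.norm_eq_abs, abs_of_nonneg hl0]
        gcongr
        · exact (ContinuousLinearMap.opNorm_comp_le _ _).trans (by gcongr)
        · refine (ContinuousLinearMap.opNorm_comp_le _ _).trans ?_
          gcongr
          exact hE1.trans (by gcongr)
    _ = _ := by ring

variable [CompleteSpace V] [CompleteSpace H]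
  {X : Type*} [NormedAddCommGroup X] [InnerProductSpace ℝ X] [CompleteSpace X]
  {e : V ≃L[ℝ] X}

/-- The approximate residual, the estimator and the updated vector for one accuracy. -/
theorem estimator_bounds {S : Solver V H} (he : ∀ v w, ⟪e v, e w⟫_ℝ = A v w)
    (hA : IsEllipticSetting S.j A α σ₀ σ₁) (hP : IsPreconditioner A S.P S.γP)
    (happ : IsApproximation S.j A S.Aop S.Eop) {ε : ℝ} (hε : 0 < ε)
    (hε₀ : ε ≤ initialAccuracy σ₀) {v : V} (hv : v ≠ 0) {l₂ : ℝ} (hl : rayleigh S.j A v ≤ l₂)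
    (hc₂ : boundC2 α σ₀ l₂ ≤ S.c₂) (hγ : 0 ≤ S.γP) :
    (1 - S.γP) * (rho S.j A v - S.c₂ * ε) ≤ S.estimator ε v ∧
      S.estimator ε v ≤ (1 + S.γP) * (rho S.j A v + S.c₂ * ε) ∧
      ‖e (v - S.P.symm (S.approxResidual ε v)) -
          rayleigh S.j A v • solutionOp S.j e (e v)‖ ≤
        (S.γP * rho S.j A v + (1 + S.γP) * S.c₂ * ε) * ‖e v‖ := by
  have hσ := hA.sigma_pos
  have hsσ : 0 < √σ₀ := Real.sqrt_pos.2 hσ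
  have hev : 0 < ‖e v‖ := norm_pos_iff.2 ((map_ne_zero_iff e e.injective).2 hv)
  have hnorm : ∀ u, √σ₀ * ‖u‖ ≤ ‖e u‖ := fun u => by
    refine le_of_sq_le_sq ?_ (norm_nonneg _)
    rw [mul_pow, Real.sq_sqrt hσ.le, ← real_inner_self_eq_norm_sq (e u), he]
    exact hA.lower_bound u
  let B : X →L[ℝ] X := (e : V →L[ℝ] X).comp ((S.P.symm : StrongDual ℝ V →L[ℝ] V).comp
    (A.comp (e.symm : X →L[ℝ] V)))
  have hB : ∀ u, B (e u) = e (S.P.symm (A u)) := fun u => by simp [B]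
  have hBs : ∀ x y, ⟪B x, y⟫_ℝ = ⟪x, B y⟫_ℝ := fun x y => by
    obtain ⟨u, rfl⟩ := e.surjective x
    obtain ⟨w, rfl⟩ := e.surjective y
    rw [hB, hB, he, he, hA.symmetric]
    have := hP.symmetric (S.P.symm (A u)) (S.P.symm (A w))
    rw [S.P.apply_symm_apply, S.P.apply_symm_apply] at this
    exact this.symm
  have hB1 : ∀ x, ‖x - B x‖ ≤ S.γP * ‖x‖ := fun x => by
    obtain ⟨u, rfl⟩ := e.surjective x
    have := hP.contraction u
    rwa [energyNorm_eq_norm he, energyNorm_eq_norm he, map_sub, ← hB] at this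
  have hB2 : ∀ x, ‖B x‖ ≤ (1 + S.γP) * ‖x‖ := fun x => by
    have h1 := norm_sub_le x (x - B x)
    rw [sub_sub_cancel] at h1
    linarith [hB1 x]
  obtain ⟨g, hg⟩ := surjective_of_inner_eq he (S.approxResidual ε v)
  obtain ⟨g₀, hg₀⟩ := surjective_of_inner_eq he (residual S.j A v)
  -- `h` represents `P v`, so `B h = v` and `‖v‖_P² = ⟨B h, h⟩`. Both norms in the estimator thus
  -- become forms of `B = P⁻¹A`.
  obtain ⟨h, hh⟩ := surjective_of_inner_eq he (S.P v)
  have hBh : B (e h) = e v := by rw [hB, hh, S.P.symm_apply_apply]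
  have heg₀ : e g₀ = e v - rayleigh S.j A v • solutionOp S.j e (e v) := by
    rw [← sub_eq_zero, ← norm_eq_zero]
    have e1 : e g₀ - (e v - rayleigh S.j A v • solutionOp S.j e (e v)) =
        e (g₀ - (v - rayleigh S.j A v • e.symm (solutionOp S.j e (e v)))) := by simp
    rw [e1, ← inverseNorm_apply he]
    have e2 : A (g₀ - (v - rayleigh S.j A v • e.symm (solutionOp S.j e (e v)))) = A 0 := by
      rw [map_sub, map_sub, map_smul, apply_symm_solutionOp he, hg₀, residual, sub_self, map_zero]
    rw [e2, inverseNorm_apply he, map_zero, norm_zero]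
  have hrho : rho S.j A v * ‖e v‖ = ‖e g₀‖ := by
    rw [rho_eq he, heg₀, div_mul_cancel₀ _ hev.ne']
  have hpert : ‖e g - e g₀‖ ≤ S.c₂ * ε * ‖e v‖ := by
    have h1 := norm_approxResidual_sub_le hA happ hε hε₀ hv hl
    rw [← hg, ← hg₀, ← map_sub] at h1
    rw [← map_sub]
    set d := g - g₀
    have h2 : ‖e d‖ ^ 2 ≤ σ₀ * boundC2 α σ₀ l₂ * (ε * ‖v‖) * ‖d‖ := by
      rw [← real_inner_self_eq_norm_sq, he]
      exact (le_abs_self _).trans (((A d).le_opNorm d).trans (by gcongr))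
    have h3 : ‖e d‖ ^ 2 ≤ S.c₂ * ε * ‖e v‖ * ‖e d‖ := by
      have hC : 0 ≤ σ₀ * boundC2 α σ₀ l₂ * (ε * ‖v‖) := (norm_nonneg _).trans h1
      have hv0 : 0 < ‖v‖ := norm_pos_iff.2 hv
      have hC' : 0 ≤ boundC2 α σ₀ l₂ := by
        have h4 := nonneg_of_mul_nonneg_left hC (by positivity)
        exact nonneg_of_mul_nonneg_right h4 hσ
      calc _ ≤ _ := h2
        -- The factor `σ₀` is split into two roots, one to bound `‖v‖` and one to bound `‖d‖` by
        -- energy norms.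
        _ = boundC2 α σ₀ l₂ * ε * (√σ₀ * ‖v‖) * (√σ₀ * ‖d‖) := by
            nth_rw 1 [← Real.mul_self_sqrt hσ.le]; ring
        _ ≤ S.c₂ * ε * ‖e v‖ * ‖e d‖ := by
            have := hC'.trans hc₂
            gcongr
            · exact hnorm v
            · exact hnorm d
    by_cases hd : ‖e d‖ = 0
    · rw [hd]
      have hC2 : 0 ≤ S.c₂ := by
        have hv0 : 0 < ‖v‖ := norm_pos_iff.2 hv
        have h4 := nonneg_of_mul_nonneg_left ((norm_nonneg _).trans h1)
          (show 0 < ε * ‖v‖ by positivity)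
        exact (nonneg_of_mul_nonneg_right h4 hσ).trans hc₂
      positivity
    · rw [sq] at h3
      exact le_of_mul_le_mul_right h3 (lt_of_le_of_ne (norm_nonneg _) (Ne.symm hd))
  have hest : S.estimator ε v = √⟪B (e g), e g⟫_ℝ / √⟪B (e h), e h⟫_ℝ := by
    rw [estimator, inverseNorm, energyNorm, ContinuousLinearMap.inverse_equiv, ← hg, hBh,
      real_inner_comm, hB, he, real_inner_comm, he, hh]
    rfl
  have hδ := sqrt_inner_div_mem hBs hγ hP.lt_one hB1 (e g) (e h)
  rw [← hest, hBh] at hδ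
  have h1γ : 0 ≤ 1 - S.γP := (sub_pos.2 hP.lt_one).le
  refine ⟨le_trans ?_ hδ.1, hδ.2.trans ?_, ?_⟩
  · gcongr
    rw [le_div_iff₀ hev, sub_mul, hrho]
    have := norm_sub_norm_le (e g₀) (e g)
    rw [norm_sub_rev] at this
    linarith
  · gcongr
    rw [div_le_iff₀ hev, add_mul, hrho]
    have := norm_sub_norm_le (e g) (e g₀)
    linarith
  · have e1 : e (v - S.P.symm (S.approxResidual ε v)) -
        rayleigh S.j A v • solutionOp S.j e (e v) = (e g₀ - B (e g₀)) - B (e g - e g₀) := by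
      rw [map_sub B, hB g, hg, map_sub e, heg₀]
      abel
    rw [e1, add_mul, mul_assoc S.γP, hrho]
    calc _ ≤ ‖e g₀ - B (e g₀)‖ + ‖B (e g - e g₀)‖ := norm_sub_le _ _
      _ ≤ S.γP * ‖e g₀‖ + (1 + S.γP) * (S.c₂ * ε * ‖e v‖) := by
          gcongr
          · exact hB1 _
          · exact (hB2 _).trans (by gcongr)
      _ = _ := by ring

end Solver

/-! ### Termination of the iteration -/

namespace Solver

variable {V H : Type*} [NormedAddCommGroup V] [NormedSpace ℝ V]
  [NormedAddCommGroup H] [InnerProductSpace ℝ H]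

theorem TerminatingRun.cons {S : Solver V H} {τ : ℝ} {v₀ : V} {m : ℕ} {v : ℕ → V} {ε : ℕ → ℝ}
    (h : S.TerminatingRun τ v₀ m v ε) {u : V} {δ : ℝ} (hu : S.Step τ u (.updated δ v₀)) :
    S.TerminatingRun τ u (m + 1) (fun n => n.casesOn u v) (fun n => n.casesOn δ ε) where
  start := rfl
  updates
    | 0, _ => by
      change S.Step τ u (.updated δ (v 0))
      rwa [h.start]
    | n + 1, hn => h.updates n (Nat.lt_of_succ_lt_succ hn)
  terminates := h.terminates

/-- The iteration terminates if every call halts and no update is possible after `M` updates. -/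
theorem exists_terminatingRun {S : Solver V H} {τ : ℝ} {Inv : ℕ → V → Prop}
    {Upd : V → ℝ → V → Prop} {Fin : V → ℝ → Prop} {M : ℕ}
    (hstep : ∀ n v, Inv n v → ∃ ε, (S.Step τ v (.finished ε v) ∧ Fin v ε) ∨
      ∃ v', S.Step τ v (.updated ε v') ∧ Upd v ε v' ∧ Inv (n + 1) v')
    (hM : ∀ n v ε v', M ≤ n → Inv n v → ¬ Upd v ε v') {v₀ : V} :
    ∀ n, Inv n v₀ → ∃ (m : ℕ) (v : ℕ → V) (ε : ℕ → ℝ), S.TerminatingRun τ v₀ m v ε ∧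
      (∀ i ≤ m, Inv (n + i) (v i)) ∧ (∀ i < m, Upd (v i) (ε i) (v (i + 1))) ∧
      Fin (v m) (ε m) := by
  -- Induction on a budget `k` of remaining updates. The invariant carries the step count `n`, and
  -- an update is impossible once `n ≥ M`.
  suffices H : ∀ (k n : ℕ) (v₀ : V), M ≤ n + k → Inv n v₀ →
      ∃ (m : ℕ) (v : ℕ → V) (ε : ℕ → ℝ), S.TerminatingRun τ v₀ m v ε ∧
        (∀ i ≤ m, Inv (n + i) (v i)) ∧ (∀ i < m, Upd (v i) (ε i) (v (i + 1))) ∧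
        Fin (v m) (ε m) from fun n hn => H M n v₀ (Nat.le_add_left _ _) hn
  have hfin : ∀ (n : ℕ) (v₀ : V) (ε : ℝ), Inv n v₀ → S.Step τ v₀ (.finished ε v₀) → Fin v₀ ε →
      ∃ (m : ℕ) (v : ℕ → V) (ε : ℕ → ℝ), S.TerminatingRun τ v₀ m v ε ∧
        (∀ i ≤ m, Inv (n + i) (v i)) ∧ (∀ i < m, Upd (v i) (ε i) (v (i + 1))) ∧
        Fin (v m) (ε m) := fun n v₀ ε hI hs hF => by
    refine ⟨0, fun _ => v₀, fun _ => ε, ⟨rfl, fun i hi => absurd hi (Nat.not_lt_zero _), hs⟩,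
      fun i hi => ?_, fun i hi => absurd hi (Nat.not_lt_zero _), hF⟩
    rw [Nat.le_zero.1 hi]
    exact hI
  intro k
  induction k with
  | zero =>
    intro n v₀ hk hI
    obtain ⟨ε, ⟨hs, hF⟩ | ⟨v', -, hU, -⟩⟩ := hstep n v₀ hI
    · exact hfin n v₀ ε hI hs hF
    · exact absurd hU (hM n v₀ ε v' (by simpa using hk) hI)
  | succ k ih =>
    intro n v₀ hk hI
    obtain ⟨δ, ⟨hs, hF⟩ | ⟨v', hs, hU, hI'⟩⟩ := hstep n v₀ hI
    · exact hfin n v₀ δ hI hs hF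
    · obtain ⟨m, v, ε, hrun, hInv, hUpd, hF⟩ := ih (n + 1) v' (by omega) hI'
      refine ⟨m + 1, _, _, hrun.cons hs, ?_, ?_, hF⟩
      · rintro (_ | i) hi
        · exact hI
        · have := hInv i (by omega)
          rwa [show n + 1 + i = n + (i + 1) by omega] at this
      · rintro (_ | i) hi
        · change Upd v₀ δ (v 0)
          rwa [hrun.start]
        · exact hUpd i (by omega)

end Solver

/-! ### The angle to the first eigenspace -/

section Angle

variable {V X : Type*} [NormedAddCommGroup V] [NormedSpace ℝ V]
  [NormedAddCommGroup X] [InnerProductSpace ℝ X]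

/-- The infimum is at most the acute angle between `v` and its component `u`, and the sine is
increasing up to `π / 2`. -/
theorem sin_angleA_le {A : V →L[ℝ] StrongDual ℝ V} {e : V ≃L[ℝ] X}
    (he : ∀ v w, ⟪e v, e w⟫_ℝ = A v w) {W : Submodule ℝ V} {v u : V} {w : X} (hu : u ∈ W)
    (hu0 : u ≠ 0) (hv : e v = e u + w) (horth : ⟪e u, w⟫_ℝ = 0) :
    Real.sin (angleA A v W) ≤ ‖w‖ / ‖e v‖ := by
  have heu : 0 < ‖e u‖ := norm_pos_iff.2 ((map_ne_zero_iff e e.injective).2 hu0)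
  have hsq : ‖e v‖ ^ 2 = ‖e u‖ ^ 2 + ‖w‖ ^ 2 := by
    rw [hv, norm_add_sq_real, horth]; ring
  have hev : 0 < ‖e v‖ := by
    refine lt_of_le_of_ne (norm_nonneg _) fun h => ?_
    rw [← h] at hsq
    have : 0 < ‖e u‖ ^ 2 + ‖w‖ ^ 2 := by positivity
    rw [← hsq] at this
    norm_num at this
  have hin : A v u = ‖e u‖ ^ 2 := by
    rw [← he, hv, inner_add_left, real_inner_self_eq_norm_sq, real_inner_comm, horth, add_zero]
  have hval : A v u / (energyNorm A v * energyNorm A u) = ‖e u‖ / ‖e v‖ := by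
    rw [energyNorm_eq_norm he, energyNorm_eq_norm he, hin]
    field_simp
  have hle : angleA A v W ≤ Real.arccos (‖e u‖ / ‖e v‖) := by
    rw [← hval]
    exact ciInf_le (f := fun w : {w : V // w ∈ W ∧ w ≠ 0} =>
      Real.arccos (A v w.1 / (energyNorm A v * energyNorm A w.1)))
      ⟨0, by rintro _ ⟨z, rfl⟩; exact Real.arccos_nonneg _⟩ ⟨u, hu, hu0⟩
  have hnonneg : 0 ≤ angleA A v W := Real.iInf_nonneg fun _ => Real.arccos_nonneg _
  calc Real.sin (angleA A v W) ≤ Real.sin (Real.arccos (‖e u‖ / ‖e v‖)) :=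
        Real.sin_le_sin_of_le_of_le_pi_div_two (by linarith [Real.pi_pos])
          (Real.arccos_le_pi_div_two.2 (by positivity)) hle
    _ = √(1 - (‖e u‖ / ‖e v‖) ^ 2) := Real.sin_arccos _
    _ ≤ ‖w‖ / ‖e v‖ := by
        refine Real.sqrt_le_iff.2 ⟨by positivity, le_of_eq ?_⟩
        rw [div_pow, div_pow]
        field_simp
        linarith

end Angle

/-! ### One call at a vector with Rayleigh quotient below `λ₂` -/

section Main

variable {V H : Type*} [NormedAddCommGroup V] [NormedSpace ℝ V]
  [NormedAddCommGroup H] [InnerProductSpace ℝ H]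
  {X : Type*} [NormedAddCommGroup X] [InnerProductSpace ℝ X]
  {e : V ≃L[ℝ] X} {A : V →L[ℝ] StrongDual ℝ V} {α σ₀ σ₁ : ℝ} {N : ℕ} {lam : ℕ → ℝ} {Λ : ℝ}

theorem finiteDimensional_energyEigenspace {j : V →L[ℝ] H}
    (hspec : HasDiscreteLowerSpectrum j A N lam Λ) (hN : 2 ≤ N) :
    FiniteDimensional ℝ (energyEigenspace j e A (lam 1)) := by
  have := hspec.finiteDimensional 1 ⟨le_rfl, by omega⟩
  exact inferInstanceAs (FiniteDimensional ℝ
    ((weakEigenspace j A (lam 1)).map (e.toLinearEquiv : V →ₗ[ℝ] X)))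

theorem rho_nonneg {j : V →L[ℝ] H} (v : V) : 0 ≤ rho j A v :=
  div_nonneg (Real.sqrt_nonneg _) (Real.sqrt_nonneg _)

variable [CompleteSpace H] [CompleteSpace X]

theorem rayleigh_mul_inner {j : V →L[ℝ] H} (he : ∀ v w, ⟪e v, e w⟫_ℝ = A v w)
    (hj : Function.Injective j) {v : V} (hv : v ≠ 0) :
    rayleigh j A v * ⟪solutionOp j e (e v), e v⟫_ℝ = ‖e v‖ ^ 2 := by
  have := inner_solutionOp_pos (e := e) hj ((map_ne_zero_iff e e.injective).2 hv)
  rw [rayleigh_eq he, div_mul_cancel₀ _ this.ne']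

theorem lam_one_le_rayleigh {j : V →L[ℝ] H} (he : ∀ v w, ⟪e v, e w⟫_ℝ = A v w)
    (hj : Function.Injective j) (hspec : HasDiscreteLowerSpectrum j A N lam Λ) (hN : 2 ≤ N)
    {v : V} (hv : v ≠ 0) : lam 1 ≤ rayleigh j A v := by
  have h1 := inner_solutionOp_pos (e := e) hj ((map_ne_zero_iff e e.injective).2 hv)
  have h2 := inner_solutionOp_le he hspec hN (e v)
  rw [rayleigh_eq he, le_div_iff₀ h1]
  rwa [inv_mul_eq_div, le_div_iff₀' (hspec.lam_one_pos hN)] at h2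

variable [CompleteSpace V]

theorem rho_sq_le {j : V →L[ℝ] H} (he : ∀ v w, ⟪e v, e w⟫_ℝ = A v w)
    (hj : Function.Injective j) (hspec : HasDiscreteLowerSpectrum j A N lam Λ) (hN : 2 ≤ N)
    {v : V} (hv : v ≠ 0) : rho j A v ^ 2 ≤ (rayleigh j A v - lam 1) / lam 1 := by
  have hev : 0 < ‖e v‖ := norm_pos_iff.2 ((map_ne_zero_iff e e.injective).2 hv)
  rw [rho_eq he, div_pow, div_le_iff₀ (by positivity)]
  exact norm_residual_sq_le inner_solutionOp_symm inner_solutionOp_nonneg (hspec.lam_one_pos hN)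
    (inner_solutionOp_le he hspec hN) (rayleigh_mul_inner he hj hv)

theorem sin_angleA_le_mul_rho {j : V →L[ℝ] H} (he : ∀ v w, ⟪e v, e w⟫_ℝ = A v w)
    (hj : Function.Injective j) (hspec : HasDiscreteLowerSpectrum j A N lam Λ) (hN : 2 ≤ N)
    {v : V} (hv : v ≠ 0) (hlam : rayleigh j A v < lam 2) :
    Real.sin (angleA A v (weakEigenspace j A (lam 1))) ≤
      lam 2 / (lam 2 - rayleigh j A v) * rho j A v := by
  have := finiteDimensional_energyEigenspace (e := e) hspec hN
  have h1 := hspec.lam_one_pos hN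
  have h2 : 0 < lam 2 := h1.trans (hspec.lam_one_lt hN)
  have hl := lam_one_le_rayleigh he hj hspec hN hv
  have hev : 0 < ‖e v‖ := norm_pos_iff.2 ((map_ne_zero_iff e e.injective).2 hv)
  obtain ⟨y, hy, w, hw, hyw⟩ :=
    (energyEigenspace j e A (lam 1)).exists_add_mem_mem_orthogonal (e v)
  obtain ⟨u, hu, rfl⟩ := hy
  change e v = e u + w at hyw
  have hmem : e u ∈ energyEigenspace j e A (lam 1) := ⟨u, hu, rfl⟩
  -- A vector orthogonal to the first eigenspace has Rayleigh quotient at least `λ₂`.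
  have hu0 : u ≠ 0 := by
    rintro rfl
    rw [map_zero, zero_add] at hyw
    have h3 := inner_solutionOp_le_of_mem_orthogonal he hspec hN hw
    rw [← hyw, ← rayleigh_mul_inner he hj hv, inv_mul_eq_div, le_div_iff₀' h2] at h3
    have h4 := inner_solutionOp_pos (e := e) hj ((map_ne_zero_iff e e.injective).2 hv)
    exact absurd (le_of_mul_le_mul_right h3 h4) (not_le.2 hlam)
  have hpart := norm_orthogonal_part_le (T := solutionOp j e)
    (fun x hx => (mem_energyEigenspace_iff he h1.ne' x).1 hx)
    (fun w hw => inner_solutionOp_le_of_mem_orthogonal he hspec hN hw) (h1.trans_le hl) h2 hmem hw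
  rw [← hyw] at hpart
  refine (sin_angleA_le he hu hu0 hyw ((Submodule.mem_orthogonal _ _).1 hw _ hmem)).trans ?_
  rw [rho_eq he, div_mul_div_comm, div_le_div_iff₀ hev (mul_pos (sub_pos.2 hlam) hev)]
  calc ‖w‖ * ((lam 2 - rayleigh j A v) * ‖e v‖)
      = (lam 2 - rayleigh j A v) * ‖w‖ * ‖e v‖ := by ring
    _ ≤ _ := by gcongr

/-- One call of the algorithm at a vector with Rayleigh quotient below `λ₂`. -/
theorem exists_call {S : Solver V H} (he : ∀ v w, ⟪e v, e w⟫_ℝ = A v w)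
    (hA : IsEllipticSetting S.j A α σ₀ σ₁) (hspec : HasDiscreteLowerSpectrum S.j A N lam Λ)
    (hN : 2 ≤ N) (hP : IsPreconditioner A S.P S.γP) (happ : IsApproximation S.j A S.Aop S.Eop)
    (hγ : 0 ≤ S.γP) (hc₀ : S.c₀ = initialAccuracy σ₀) (hc₂ : boundC2 α σ₀ (lam 2) ≤ S.c₂)
    (hc₂_pos : 0 < S.c₂) (hc₃_pos : 0 < S.c₃) (hc₃ : S.c₃ ≤ boundC3 S.γP S.c₂)
    {τ : ℝ} (hτ : 0 < τ) {v : V} (hv : v ≠ 0) (hlam : rayleigh S.j A v < lam 2) :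
    ∃ ε, (ε = S.c₀ ∨
        (S.c₃ * (1 - S.γP) * rho S.j A v ≤ 2 * (1 + S.c₃ * (1 - S.γP) * S.c₂) * ε ∧
          τ ≤ 2 * ((1 - S.γP)⁻¹ / S.c₃ + S.c₂) * ε)) ∧
      ((S.Step τ v (.finished ε v) ∧ rho S.j A v ≤ τ) ∨
        ∃ v', S.Step τ v (.updated ε v') ∧
          ((1 + S.γP) * S.c₂ * ε ≤ gammaXi S.γP * rho S.j A v ∧
            τ ≤ (1 - S.γP)⁻¹ * ((1 + S.γP) * (rho S.j A v + S.c₂ * ε)) + S.c₂ * ε) ∧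
          v' ≠ 0 ∧ rayleigh S.j A v' < lam 2 ∧
          (rayleigh S.j A v' - lam 1) / (lam 2 - rayleigh S.j A v') ≤
            rate ((1 + S.γP) / 2) (lam 1) (lam 2) ^ 2 *
              ((rayleigh S.j A v - lam 1) / (lam 2 - rayleigh S.j A v)) ∧
          ‖e v'‖ ≤ (1 + 2 * rho S.j A v) * ‖e v‖) := by
  have hγ1 := hP.lt_one
  have := finiteDimensional_energyEigenspace (e := e) hspec hN
  have h1 := hspec.lam_one_pos hN
  have hev : 0 < ‖e v‖ := norm_pos_iff.2 ((map_ne_zero_iff e e.injective).2 hv)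
  have hest := fun ε (hε : 0 < ε) (hε₀ : ε ≤ S.c₀) =>
    Solver.estimator_bounds he hA hP happ hε (hc₀ ▸ hε₀) hv hlam.le hc₂ hγ
  obtain ⟨ε, hε, hε₀, hfirst, hout⟩ := Solver.exists_step_of_estimator_bounds (v := v)
    (ρ := rho S.j A v) (γξ := gammaXi S.γP) (hc₀ ▸ initialAccuracy_pos hA.sigma_pos) hc₂_pos
    hc₃_pos hγ hγ1 (by unfold gammaXi; linarith) hc₃ hτ (rho_nonneg v)
    (fun ε hε hε₀ => (hest ε hε hε₀).1) (fun ε hε hε₀ => (hest ε hε hε₀).2.1)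
  refine ⟨ε, hfirst, hout.imp And.symm fun ⟨hερ, hτρ, hstep⟩ => ⟨_, hstep, ⟨hερ, hτρ⟩, ?_⟩⟩
  have hupd := (hest ε hε hε₀).2.2
  set v' := v - S.P.symm (S.approxResidual ε v)
  have hres : ‖e v - rayleigh S.j A v • solutionOp S.j e (e v)‖ = rho S.j A v * ‖e v‖ := by
    rw [rho_eq he, div_mul_cancel₀ _ hev.ne']
  -- The radii add up: `γP + γ_ξ = (1 + γP) / 2`.
  have hball : ‖e v' - rayleigh S.j A v • solutionOp S.j e (e v)‖ ≤
      (1 + S.γP) / 2 * ‖e v - rayleigh S.j A v • solutionOp S.j e (e v)‖ := by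
    rw [hres, ← mul_assoc]
    refine hupd.trans (mul_le_mul_of_nonneg_right ?_ hev.le)
    unfold gammaXi at hερ
    linarith
  have hstep' := rayleigh_step (T := solutionOp S.j e) (E := energyEigenspace S.j e A (lam 1))
    (x := e v) (y := e v') (γ := (1 + S.γP) / 2) inner_solutionOp_symm
    (fun x hx => inner_solutionOp_pos hA.embedding_injective hx) h1 (hspec.lam_one_lt hN)
    (fun x hx => (mem_energyEigenspace_iff he h1.ne' x).1 hx) (inner_solutionOp_le he hspec hN)
    (fun w hw => inner_solutionOp_le_of_mem_orthogonal he hspec hN hw) (by linarith) (by linarith)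
    (norm_pos_iff.1 hev) (by rwa [← rayleigh_eq he]) (by rwa [← rayleigh_eq he])
  rw [← rayleigh_eq he, ← rayleigh_eq he] at hstep'
  refine ⟨(map_ne_zero_iff e e.injective).1 hstep'.1, hstep'.2.1, hstep'.2.2, ?_⟩
  have hρ := mul_nonneg (rho_nonneg (j := S.j) (A := A) v) hev.le
  -- A crude growth bound. It suffices because the relative residuals are summable along the
  -- iteration.
  calc ‖e v'‖ = ‖(e v' - rayleigh S.j A v • solutionOp S.j e (e v)) -
        (e v - rayleigh S.j A v • solutionOp S.j e (e v)) + e v‖ := by congr 1; abel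
    _ ≤ (1 + S.γP) / 2 * (rho S.j A v * ‖e v‖) + rho S.j A v * ‖e v‖ + ‖e v‖ := by
        rw [hres] at hball
        refine (norm_add_le _ _).trans ?_
        gcongr
        exact (norm_sub_le _ _).trans (by rw [hres]; gcongr)
    _ ≤ _ := by
        have : (1 + S.γP) / 2 * (rho S.j A v * ‖e v‖) ≤ 1 * (rho S.j A v * ‖e v‖) := by
          gcongr; linarith
        linarith

end Main

/-! ### Assembly: constants, invariant and conclusion -/

theorem rho_le_of_ratio_le {ρ a b l t : ℝ} (hρ : ρ ^ 2 ≤ (l - a) / a) (ha : 0 < a) (hal : a ≤ l)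
    (hlb : l < b) (ht : (l - a) / (b - l) ≤ t) : ρ ^ 2 ≤ (b - a) / a * t := by
  have h0 : 0 ≤ (l - a) / (b - l) := div_nonneg (by linarith) (by linarith)
  rw [div_le_iff₀ (by linarith)] at ht
  have h1 : t * (b - l) ≤ t * (b - a) := by
    refine mul_le_mul_of_nonneg_left (by linarith) ?_
    exact nonneg_of_mul_nonneg_left ((sub_nonneg.2 hal).trans ht) (by linarith)
  calc ρ ^ 2 ≤ (l - a) / a := hρ
    _ ≤ t * (b - a) / a := by gcongr; linarith
    _ = _ := by ring

/-- If the call ends at the initial accuracy, nothing relates it to `τ`. Truncating `τ` at 1 bounds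
the maximum by `M + 1`, so the quotient `c₀ / (M + 1)` covers this case. -/
theorem mul_max_le_of_alternatives {c₀ M κ₁ κ₂ ρ τ ε : ℝ} (hc₀ : 0 < c₀) (hM : 0 ≤ M)
    (hκ₂ : 0 < κ₂) (hρ : 0 ≤ ρ) (hρM : ρ ≤ M) (hτ : 0 < τ)
    (h : ε = c₀ ∨ (κ₁ * ρ ≤ ε ∧ κ₂ * τ ≤ ε)) :
    min (min κ₁ κ₂) (c₀ / (M + 1)) * max (min τ 1) ρ ≤ ε := by
  have hmax : 0 ≤ max (min τ 1) ρ := hρ.trans (le_max_right _ _)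
  rcases h with rfl | ⟨h1, h2⟩
  · calc _ ≤ ε / (M + 1) * (M + 1) := by
          gcongr
          · exact min_le_right _ _
          · exact max_le ((min_le_right _ _).trans (by linarith)) (by linarith)
      _ = ε := by field_simp
  · rcases max_cases (min τ 1) ρ with ⟨h3, -⟩ | ⟨h3, -⟩
    · rw [h3]
      refine le_trans ?_ h2
      have : 0 ≤ min τ 1 := le_min hτ.le zero_le_one
      gcongr
      · exact (min_le_left _ _).trans (min_le_right _ _)
      · exact min_le_left _ _
    · rw [h3]
      refine le_trans ?_ h1
      gcongr
      exact (min_le_left _ _).trans (min_le_left _ _)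

theorem boundC2_pos {α σ₀ l : ℝ} (hσ : 0 < σ₀) (hl : 0 < l) : 0 < boundC2 α σ₀ l := by
  unfold boundC2 boundC1
  positivity

end PPINVIT

end

theorem mainTheorem5 {V H : Type*}
    [NormedAddCommGroup V] [NormedSpace ℝ V] [CompleteSpace V]
    [TopologicalSpace.SeparableSpace V]
    [NormedAddCommGroup H] [InnerProductSpace ℝ H] [CompleteSpace H]
    [TopologicalSpace.SeparableSpace H]
    (j : V →L[ℝ] H) (A : V →L[ℝ] StrongDual ℝ V) (α σ₀ σ₁ : ℝ)
    (hA : PPINVIT.IsEllipticSetting j A α σ₀ σ₁)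
    (N : ℕ) (hN : 2 ≤ N) (lam : ℕ → ℝ) (Λ : ℝ)
    (hspec : PPINVIT.HasDiscreteLowerSpectrum j A N lam Λ)
    (P : V ≃L[ℝ] StrongDual ℝ V) (γP : ℝ) (hP : PPINVIT.IsPreconditioner A P γP)
    (c₂ : ℝ) (hc₂ : PPINVIT.boundC2 α σ₀ (lam 2) ≤ c₂)
    (c₃ : ℝ) (hc₃_pos : 0 < c₃) (hc₃ : c₃ ≤ PPINVIT.boundC3 γP c₂) :
    -- `c`, `C` are independent of the approximations, of the starting vector and of `τ`
    ∃ c > 0, ∃ C > 0,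
    -- `D` depends in addition on an upper bound for the Rayleigh quotient of the starting vector
    ∀ lam₀ < lam 2, ∃ D > 0,
    ∀ (Aop : ℝ → V → StrongDual ℝ V) (Eop : ℝ → V → StrongDual ℝ H),
    PPINVIT.IsApproximation j A Aop Eop →
    ∀ τ > 0, ∀ v₀ : V, v₀ ≠ 0 → PPINVIT.rayleigh j A v₀ ≤ lam₀ →
    ∃ (m : ℕ) (v : ℕ → V) (ε : ℕ → ℝ),
      -- the iteration terminates after finitely many steps, each of which halts
      PPINVIT.Solver.TerminatingRun
        { j := j, P := P, Aop := Aop, Eop := Eop, γP := γP,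
          c₀ := PPINVIT.initialAccuracy σ₀, c₂ := c₂, c₃ := c₃ } τ v₀ m v ε ∧
      (∀ n ≤ m, v n ≠ 0 ∧ lam 1 ≤ PPINVIT.rayleigh j A (v n) ∧
        PPINVIT.rayleigh j A (v n) < lam 2) ∧
      -- geometric decrease of the error of the Rayleigh quotient
      (∀ n < m,
        (PPINVIT.rayleigh j A (v (n + 1)) - lam 1) /
            (lam 2 - PPINVIT.rayleigh j A (v (n + 1))) ≤
          PPINVIT.rate ((1 + γP) / 2) (lam 1) (lam 2) ^ 2 *
            ((PPINVIT.rayleigh j A (v n) - lam 1) /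
              (lam 2 - PPINVIT.rayleigh j A (v n)))) ∧
      -- in each update the accuracy is proportional to the relative residual
      (∀ n < m, c * PPINVIT.rho j A (v n) ≤ ε n ∧ ε n ≤ C * PPINVIT.rho j A (v n)) ∧
      -- decrease of the residual
      (∀ n ≤ m,
        PPINVIT.rho j A (v n) ≤ D * PPINVIT.rate ((1 + γP) / 2) (lam 1) (lam 2) ^ n ∧
        PPINVIT.inverseNorm A (PPINVIT.residual j A (v n)) ≤
          D * PPINVIT.rate ((1 + γP) / 2) (lam 1) (lam 2) ^ n * PPINVIT.energyNorm A v₀) ∧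
      -- accuracy of the final iterand
      PPINVIT.rho j A (v m) ≤ τ ∧
      Real.sin (PPINVIT.angleA A (v m) (PPINVIT.weakEigenspace j A (lam 1))) ≤ D * τ ∧
      -- the accuracies stay bounded from below
      (∀ n ≤ m, c * max (min τ 1) (PPINVIT.rho j A (v n)) ≤ ε n) := by
  obtain ⟨X, _, _, _, e, he⟩ := PPINVIT.exists_energySpace hA.symmetric hA.sigma_pos hA.lower_bound
    hA.upper_bound
  have hj := hA.embedding_injective
  have h1 := hspec.lam_one_pos hN
  have h12 := hspec.lam_one_lt hN
  have h2 : 0 < lam 2 := h1.trans h12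
  have hγ1 := hP.lt_one
  -- The contraction bound at a nonzero vector, here an eigenvector, forces `γP ≥ 0`.
  have hγ : 0 ≤ γP := by
    obtain ⟨u, -, hu⟩ := (Submodule.ne_bot_iff _).1 (hspec.isEigenvalue 1 ⟨le_rfl, by omega⟩)
    have h3 := hP.contraction u
    rw [PPINVIT.energyNorm_eq_norm he u] at h3
    exact nonneg_of_mul_nonneg_left ((Real.sqrt_nonneg _).trans h3)
      (norm_pos_iff.2 ((map_ne_zero_iff e e.injective).2 hu))
  have h1γ : 0 < 1 - γP := sub_pos.2 hγ1
  have hc₂_pos : 0 < c₂ := (PPINVIT.boundC2_pos hA.sigma_pos h2).trans_le hc₂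
  have hξ : 0 < PPINVIT.gammaXi γP := by unfold PPINVIT.gammaXi; linarith
  have hq0 := PPINVIT.rate_pos (show 0 ≤ (1 + γP) / 2 by linarith) (by linarith) h1 h12
  have hq1 := PPINVIT.rate_lt_one (show (1 + γP) / 2 < 1 by linarith) h1 h12
  have hc₀ := PPINVIT.initialAccuracy_pos hA.sigma_pos
  set q := PPINVIT.rate ((1 + γP) / 2) (lam 1) (lam 2)
  -- Bounds `ρ(u)` for every nonzero `u` with `λ(u) < λ₂`.
  set M := √((lam 2 - lam 1) / lam 1)
  obtain ⟨κ₁, hκ₁, hκ₁'⟩ : ∃ κ₁ > 0, ∀ ρ ε : ℝ,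
      c₃ * (1 - γP) * ρ ≤ 2 * (1 + c₃ * (1 - γP) * c₂) * ε → κ₁ * ρ ≤ ε := by
    refine ⟨(2 * (1 + c₃ * (1 - γP) * c₂))⁻¹ * (c₃ * (1 - γP)), by positivity, fun ρ ε h => ?_⟩
    rw [mul_assoc, inv_mul_le_iff₀ (by positivity)]
    exact h
  obtain ⟨κ₂, hκ₂, hκ₂'⟩ : ∃ κ₂ > 0, ∀ ε τ : ℝ,
      τ ≤ 2 * ((1 - γP)⁻¹ / c₃ + c₂) * ε → κ₂ * τ ≤ ε := by
    refine ⟨(2 * ((1 - γP)⁻¹ / c₃ + c₂))⁻¹, by positivity, fun ε τ h => ?_⟩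
    rwa [inv_mul_le_iff₀ (by positivity)]
  obtain ⟨C, hC, hC'⟩ : ∃ C > 0, ∀ ρ ε : ℝ,
      (1 + γP) * c₂ * ε ≤ PPINVIT.gammaXi γP * ρ → ε ≤ C * ρ := by
    refine ⟨((1 + γP) * c₂)⁻¹ * PPINVIT.gammaXi γP, by positivity, fun ρ ε h => ?_⟩
    rw [mul_assoc, le_inv_mul_iff₀ (by positivity)]
    exact h
  -- In an update the failed stopping test and `ε ≤ C ρ` together give `τ ≤ K ρ`.
  set K := (1 - γP)⁻¹ * ((1 + γP) * (1 + c₂ * C)) + c₂ * C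
  have hK : 0 < K := by positivity
  have hM : 0 ≤ M := Real.sqrt_nonneg _
  refine ⟨min (min κ₁ κ₂) (PPINVIT.initialAccuracy σ₀ / (M + 1)),
    lt_min (lt_min hκ₁ hκ₂) (by positivity), C, hC, fun lam₀ hlam₀ => ?_⟩
  set t₀ := (lam₀ - lam 1) / (lam 2 - lam₀) with ht₀
  set D₀ := √((lam 2 - lam 1) / lam 1 * t₀)
  have hD₀ : 0 ≤ D₀ := Real.sqrt_nonneg _
  -- Bounds the product of all growth factors: `∏ (1 + 2 D₀ qⁱ) ≤ exp (2 D₀ ∑ qⁱ)`.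
  set G := Real.exp (2 * D₀ * (1 - q)⁻¹)
  have hgap : 0 < lam 2 - lam₀ := sub_pos.2 hlam₀
  -- The summands serve the absolute residual, the relative residual and the angle, in this order.
  refine ⟨D₀ * G + D₀ + lam 2 / (lam 2 - lam₀), by positivity, ?_⟩
  set D := D₀ * G + D₀ + lam 2 / (lam 2 - lam₀) with hD
  have hDG : D₀ * G ≤ D := by
    have : 0 < lam 2 / (lam 2 - lam₀) := by positivity
    linarith
  have hDD : D₀ ≤ D := by
    have h3 : 0 < lam 2 / (lam 2 - lam₀) := by positivity
    have h4 : 0 ≤ D₀ * G := by positivity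
    linarith
  have hDs : lam 2 / (lam 2 - lam₀) ≤ D := by
    have h4 : 0 ≤ D₀ * G := by positivity
    linarith
  intro Aop Eop happ τ hτ v₀ hv₀ hrv₀
  set S : PPINVIT.Solver V H :=
    { j := j, P := P, Aop := Aop, Eop := Eop, γP := γP,
      c₀ := PPINVIT.initialAccuracy σ₀, c₂ := c₂, c₃ := c₃ }
  have hlam1 : ∀ u : V, u ≠ 0 → lam 1 ≤ PPINVIT.rayleigh j A u := fun u hu =>
    PPINVIT.lam_one_le_rayleigh he hj hspec hN hu
  have ht₀' : 0 ≤ t₀ := div_nonneg (by linarith [hlam1 v₀ hv₀]) hgap.le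
  let Inv : ℕ → V → Prop := fun n u => u ≠ 0 ∧ PPINVIT.rayleigh j A u < lam 2 ∧
    (PPINVIT.rayleigh j A u - lam 1) / (lam 2 - PPINVIT.rayleigh j A u) ≤ (q ^ n) ^ 2 * t₀ ∧
    ‖e u‖ ≤ Real.exp (2 * D₀ * ∑ i ∈ Finset.range n, q ^ i) * ‖e v₀‖
  have hInvρ : ∀ n u, Inv n u → PPINVIT.rho j A u ≤ D₀ * q ^ n := fun n u ⟨hu, hl, ht, _⟩ => by
    refine le_of_sq_le_sq ?_ (by positivity)
    have h0 : 0 ≤ (lam 2 - lam 1) / lam 1 * t₀ :=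
      mul_nonneg (div_nonneg (by linarith) h1.le) ht₀'
    rw [mul_pow, Real.sq_sqrt h0]
    refine (PPINVIT.rho_le_of_ratio_le (PPINVIT.rho_sq_le he hj hspec hN hu) h1 (hlam1 u hu) hl
      ht).trans (le_of_eq (by ring))
  have hInv0 : Inv 0 v₀ := by
    refine ⟨hv₀, hrv₀.trans_lt hlam₀, ?_, by simp⟩
    rw [pow_zero, one_pow, one_mul, ht₀, div_le_div_iff₀ (by linarith) hgap]
    linear_combination mul_nonneg (sub_nonneg.2 hrv₀) (sub_nonneg.2 h12.le)
  let Low : V → ℝ → Prop := fun u ε => min (min κ₁ κ₂) (PPINVIT.initialAccuracy σ₀ / (M + 1)) *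
    max (min τ 1) (PPINVIT.rho j A u) ≤ ε
  let Upd : V → ℝ → V → Prop := fun u ε u' => Low u ε ∧ ε ≤ C * PPINVIT.rho j A u ∧
    τ ≤ K * PPINVIT.rho j A u ∧
    (PPINVIT.rayleigh j A u' - lam 1) / (lam 2 - PPINVIT.rayleigh j A u') ≤
      q ^ 2 * ((PPINVIT.rayleigh j A u - lam 1) / (lam 2 - PPINVIT.rayleigh j A u))
  have hstep : ∀ n u, Inv n u → ∃ ε, (S.Step τ u (.finished ε u) ∧
      (Low u ε ∧ PPINVIT.rho j A u ≤ τ)) ∨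
      ∃ u', S.Step τ u (.updated ε u') ∧ Upd u ε u' ∧ Inv (n + 1) u' := by
    rintro n u hI
    have hρ := hInvρ n u hI
    obtain ⟨hu, hl, ht, hn⟩ := hI
    have hρ0 : 0 ≤ PPINVIT.rho j A u := PPINVIT.rho_nonneg u
    have hρM : PPINVIT.rho j A u ≤ M := by
      refine Real.le_sqrt_of_sq_le ((PPINVIT.rho_sq_le he hj hspec hN hu).trans ?_)
      gcongr
    obtain ⟨ε, hfirst, hout⟩ := PPINVIT.exists_call (S := S) he hA hspec hN hP happ hγ rfl hc₂
      hc₂_pos hc₃_pos hc₃ hτ hu hl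
    have hLow : Low u ε := PPINVIT.mul_max_le_of_alternatives hc₀ hM hκ₂ hρ0 hρM hτ
      (hfirst.imp_right fun h => ⟨hκ₁' _ _ h.1, hκ₂' _ _ h.2⟩)
    refine ⟨ε, hout.imp (fun h => ⟨h.1, hLow, h.2⟩) ?_⟩
    rintro ⟨u', hs, ⟨hερ, hτρ⟩, hu', hl', hratio, hnorm⟩
    have hεC : ε ≤ C * PPINVIT.rho j A u := hC' _ _ hερ
    refine ⟨u', hs, ⟨hLow, hεC, ?_, hratio⟩, hu', hl', ?_, ?_⟩
    · calc τ ≤ (1 - γP)⁻¹ * ((1 + γP) * (PPINVIT.rho j A u + c₂ * ε)) + c₂ * ε := hτρ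
        _ ≤ (1 - γP)⁻¹ * ((1 + γP) * (PPINVIT.rho j A u + c₂ * (C * PPINVIT.rho j A u))) +
            c₂ * (C * PPINVIT.rho j A u) := by gcongr
        _ = _ := by ring
    · calc _ ≤ _ := hratio
        _ ≤ q ^ 2 * ((q ^ n) ^ 2 * t₀) := by gcongr
        _ = _ := by ring
    · calc ‖e u'‖ ≤ (1 + 2 * PPINVIT.rho j A u) * ‖e u‖ := hnorm
        _ ≤ Real.exp (2 * D₀ * q ^ n) *
            (Real.exp (2 * D₀ * ∑ i ∈ Finset.range n, q ^ i) * ‖e v₀‖) := by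
            gcongr
            have := Real.add_one_le_exp (2 * D₀ * q ^ n)
            linarith
        _ = _ := by
            rw [← mul_assoc, ← Real.exp_add, Finset.sum_range_succ]
            ring_nf
  -- From step `m₀` on `K ρ < τ`, so no further update can occur. The denominator `K D₀ + 1` allows
  -- for `D₀ = 0`.
  obtain ⟨m₀, hm₀⟩ : ∃ m₀ : ℕ, K * (D₀ * q ^ m₀) < τ := by
    obtain ⟨m₀, h⟩ := exists_pow_lt_of_lt_one (show 0 < τ / (K * D₀ + 1) by positivity) hq1
    refine ⟨m₀, ?_⟩
    rw [lt_div_iff₀ (by positivity)] at h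
    have : 0 < q ^ m₀ := by positivity
    linarith
  obtain ⟨m, v, ε, hrun, hInv, hUpd, hF⟩ := PPINVIT.Solver.exists_terminatingRun (M := m₀)
    (Fin := fun u ε => Low u ε ∧ PPINVIT.rho j A u ≤ τ) hstep (fun n u ε u' hn hI hU => by
      have h3 : q ^ n ≤ q ^ m₀ := pow_le_pow_of_le_one hq0.le hq1.le hn
      have h4 : K * PPINVIT.rho j A u ≤ K * (D₀ * q ^ m₀) := by
        gcongr
        exact (hInvρ n u hI).trans (by gcongr)
      linarith [hU.2.2.1]) 0 hInv0
  simp only [zero_add] at hInv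
  have hLow : ∀ n ≤ m, Low (v n) (ε n) := fun n hn => by
    rcases hn.lt_or_eq with h | rfl
    · exact (hUpd n h).1
    · exact hF.1
  have hvG : ∀ n ≤ m, ‖e (v n)‖ ≤ G * ‖e v₀‖ := fun n hn => by
    refine (hInv n hn).2.2.2.trans ?_
    have hsum : ∑ i ∈ Finset.range n, q ^ i ≤ (1 - q)⁻¹ := by
      rw [← tsum_geometric_of_lt_one hq0.le hq1]
      exact (summable_geometric_of_lt_one hq0.le hq1).sum_le_tsum _ (fun i _ => by positivity)
    exact mul_le_mul_of_nonneg_right (Real.exp_le_exp.2 (by gcongr)) (norm_nonneg _)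
  refine ⟨m, v, ε, hrun, fun n hn => ⟨(hInv n hn).1, hlam1 _ (hInv n hn).1, (hInv n hn).2.1⟩,
    fun n hn => (hUpd n hn).2.2.2, fun n hn => ⟨?_, (hUpd n hn).2.1⟩, fun n hn => ⟨?_, ?_⟩, hF.2,
    ?_, hLow⟩
  · refine le_trans ?_ (hLow n hn.le)
    gcongr
    exact le_max_right _ _
  · exact (hInvρ n _ (hInv n hn)).trans (by gcongr)
  · have hev : 0 < ‖e (v n)‖ :=
      norm_pos_iff.2 ((map_ne_zero_iff e e.injective).2 (hInv n hn).1)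
    have hρ := hInvρ n _ (hInv n hn)
    rw [PPINVIT.rho, PPINVIT.energyNorm_eq_norm he, div_le_iff₀ hev] at hρ
    rw [PPINVIT.energyNorm_eq_norm he]
    calc _ ≤ _ := hρ
      _ ≤ D₀ * q ^ n * (G * ‖e v₀‖) := by gcongr; exact hvG n hn
      _ = D₀ * G * q ^ n * ‖e v₀‖ := by ring
      _ ≤ _ := by gcongr
  · obtain ⟨hvm, hlm, htm, -⟩ := hInv m le_rfl
    -- The ratio at `v m` is at most its value `t₀` at `lam₀`, and the ratio increases with the
    -- Rayleigh quotient. This keeps the gap to `λ₂` uniform in the angle estimate.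
    have hlm₀ : PPINVIT.rayleigh j A (v m) ≤ lam₀ := by
      have h3 : (q ^ m) ^ 2 ≤ 1 := pow_le_one₀ (by positivity) (pow_le_one₀ hq0.le hq1.le)
      have h4 := htm.trans (mul_le_of_le_one_left ht₀' h3)
      rw [ht₀, div_le_div_iff₀ (by linarith) hgap] at h4
      refine le_of_mul_le_mul_right ?_ (sub_pos.2 h12)
      linear_combination h4
    calc _ ≤ lam 2 / (lam 2 - PPINVIT.rayleigh j A (v m)) * PPINVIT.rho j A (v m) :=
          PPINVIT.sin_angleA_le_mul_rho he hj hspec hN hvm hlm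
      _ ≤ lam 2 / (lam 2 - lam₀) * τ := by
          have := PPINVIT.rho_nonneg (j := j) (A := A) (v m)
          gcongr
          exact hF.2
      _ ≤ D * τ := by gcongr
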